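/- For a function $f$ on $\mathbb{R}$ let $H(f)(x)=\frac1\pi\,\mathrm{P.V.}\int_{\mathbb{R}}\frac{f(y)}{x-y}\,dy$ denote its Hilbert transform. Let $c_l,c_\omega:[0,\infty)\to\mathbb{R}$ be continuous and let $\Omega(X,\tau)$ be a classical ($C^1$ on $\mathbb{R}\times[0,\infty)$) solution of the dynamic rescaling equation with $a=0$, $$\Omega_\tau+c_l(\tau)\,X\,\Omega_X=\bigl(c_\omega(\tau)+H(\Omega)\bigr)\,\Omega,\qquad X\in\mathbb{R},\ \tau\ge 0,$$ such that $\Omega(\cdot,\tau)\in H^1(\mathbb{R})$ for every $\tau\ge0$, with $H^1$-norm bounded on bounded time intervals. Assume that the initial data $\Omega_0=\Omega(\cdot,0)$ is $C^\infty$ and odd, that $\Omega_0'(0)=0$ and $\Omega_0(X)<0$ for all $X>0$, and that $$\limsup_{X\to0}\left|\frac{X\,\Omega_0'(X)}{\Omega_0(X)}\right|<+\infty .$$ Assume the normalization conditions $H(\Omega)(0,\tau)=2$ and $H(\Omega)_{XX}(0,\tau)=4$ for all $\tau\ge0$. Then the scaling factors are constant, $c_l(\tau)\equiv\frac12$ and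 $c_\omega(\tau)\equiv-1$, and, as $\tau\to+\infty$, $\Omega(\cdot,\tau)$ converges to the singular profile $\bar\Omega=-\pi\bigl(\delta(X-1)-\delta(X+1)\bigr)$, whose Hilbert transform is $H(\bar\Omega)(X)=\frac{2}{1-X^2}$ for $X\ne\pm1$, in the following sense: for every $X\neq\pm1$, $$\lim_{\tau\to+\infty}\Omega(X,\tau)=0,\qquad \lim_{\tau\to+\infty}H(\Omega)(X,\tau)=\frac{2}{1-X^2},$$ and for every $\phi\in C_c^\infty(\mathbb{R})$, $$\lim_{\tau\to+\infty}\int_{-\infty}^{+\infty}\Omega(X,\tau)\,\phi(X)\,dX=-\pi\bigl(\phi(1)-\phi(-1)\bigr).$$ -/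

import Mathlib

open Filter Topology MeasureTheory Set
open scoped ContDiff

noncomputable section

/-- The Hilbert transform on the line, `H(f)(x) = (1/π) P.V. ∫ f(y)/(x-y) dy`, the principal value
being the limit as `ε → 0+` of the integral over `|x - y| > ε`. For `f` in `H¹(ℝ)`
every truncated integral converges absolutely and the limit exists at every point `x`. -/
def hilbertTransform (f : ℝ → ℝ) (x : ℝ) : ℝ :=
  limUnder (𝓝[>] (0 : ℝ)) (fun ε : ℝ => (1 / Real.pi) * ∫ y in {y : ℝ | ε < |x - y|}, f y / (x - y))

/-- Classical solutions on `[0,∞)` of the dynamic rescaling equation with `a = 0`,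
`Ω_τ + c_l X Ω_X = (c_ω + H(Ω)) Ω`, with time-dependent scaling factors `c_l`, `c_ω`.
The profile is written `Ω τ X`. It is `C¹` on `[0,∞) × ℝ`, and `Ω τ` is in `H¹(ℝ)` with a norm that
is bounded on bounded time intervals. -/
structure IsDynamicRescalingSolution (cl cω : ℝ → ℝ) (Ω : ℝ → ℝ → ℝ) : Prop where
  continuousOn_cl : ContinuousOn cl (Ici 0)
  continuousOn_cω : ContinuousOn cω (Ici 0)
  contDiffOn : ContDiffOn ℝ 1 (fun p : ℝ × ℝ => Ω p.1 p.2) (Ici 0 ×ˢ univ)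
  memLp : ∀ τ, 0 ≤ τ → MemLp (Ω τ) 2 volume
  memLp_deriv : ∀ τ, 0 ≤ τ → MemLp (deriv (Ω τ)) 2 volume
  locally_bounded : ∀ T : ℝ, ∃ M : NNReal, ∀ τ, 0 ≤ τ → τ ≤ T →
    eLpNorm (Ω τ) 2 volume ≤ M ∧ eLpNorm (deriv (Ω τ)) 2 volume ≤ M
  equation : ∀ τ, 0 ≤ τ → ∀ X : ℝ,
    HasDerivWithinAt (fun s => Ω s X)
      ((cω τ + hilbertTransform (Ω τ) X) * Ω τ X - cl τ * X * deriv (Ω τ) X) (Ici 0) τ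

/-- The distribution `-π (δ(X-1) - δ(X+1))`, as a functional; being a finite combination of
Dirac masses it acts on all functions. -/
def singularProfile (φ : ℝ → ℝ) : ℝ := -Real.pi * (φ 1 - φ (-1))

/-- The Hilbert transform of `singularProfile` at a point `X ≠ ±1` off its support: the pairing
with the kernel `y ↦ (1/π) / (X - y)`. -/
def singularProfileHilbert (X : ℝ) : ℝ :=
  singularProfile (fun y => (1 / Real.pi) * (1 / (X - y)))

end

/-! The equation is integrable by complex methods. Put `L = exp ∫ c_l`, `E = exp ∫ c_ω`, `S = ∫ E`.
In Lagrangian coordinates `W(τ, x) = Ω(τ, L x)` transport disappears and `W_τ = (c_ω + H W) W`.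
Tricomi's identity turns this into a Riccati equation `G_τ = c_ω G + G² / 2` at each point of the
upper half plane, `G` being the Cauchy transform of `W`. Hence `G (1 - S G₀ / 2) = E G₀`, where `G₀`
is the initial value. By Plemelj the same relation holds on the real line for the boundary values `H
Ω - i Ω`.

The normalizations then determine the scaling. At the origin `H Ω = 2` and `Ω = 0`, so `E = 1 - S`;
differentiating gives `c_ω = -1`. The data are `o(x²)` at the origin, because they are smooth, odd
and have zero slope there, while `H Ω - 2 ~ 2 x²`. Comparing coefficients of `x²` gives `L² E = 1`,
hence `c_l = 1/2`.

With `X = e^{t/2} x`, the formula depends on the data only through `(H Ω₀ - 2) / x² → 2` and `Ω₀ /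
x² → 0` as `x → 0`, and the pointwise limits follow. For weak convergence, consider `-Ω / y` on `(0,
∞)`: it is nonnegative, has mass `π` because `H Ω (0) = 2`, and tends to zero uniformly on bounded
sets away from `1`. Only escape of mass to infinity must be excluded, and the explicit formula on
the imaginary axis does this (`tight_density`). All the mass therefore concentrates at `1`, and
oddness supplies the opposite mass at `-1`. -/

/-! ### The Hilbert transform as an absolutely convergent integral. -/

/-- Continuous, square integrable, Hölder functions of exponent `1/2`, with bounds `A` and `B`. -/
structure HolderSq (f : ℝ → ℝ) (A B : ℝ) : Prop where
  continuous : Continuous f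
  integrable_sq : Integrable (fun x => f x ^ 2)
  holder : ∀ x y, |f x - f y| ≤ A * √|x - y|
  sq_le : ∫ x, f x ^ 2 ≤ B

/-- The symmetric difference quotient whose integral over `t > 0` is `π` times the
Hilbert transform. -/
noncomputable def symmQuot (f : ℝ → ℝ) (x t : ℝ) : ℝ := (f (x - t) - f (x + t)) / t

/-- Dominating kernel for the symmetric difference quotient. -/
noncomputable def quotBound (A t : ℝ) : ℝ :=
  if t ≤ 1 then A * √2 * t ^ (-(1/2) : ℝ) else t ^ (-2 : ℝ)

theorem integrableOn_quotBound (A : ℝ) : IntegrableOn (quotBound A) (Ioi 0) := by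
  rw [← Ioc_union_Ioi_eq_Ioi zero_le_one]
  refine IntegrableOn.union ?_ ?_
  · have h : IntegrableOn (fun t : ℝ => A * √2 * t ^ (-(1/2) : ℝ)) (Ioc 0 1) := by
      have := (intervalIntegral.intervalIntegrable_rpow' (a := 0) (b := 1)
        (r := (-(1/2) : ℝ)) (by norm_num)).const_mul (A * √2)
      rwa [intervalIntegrable_iff_integrableOn_Ioc_of_le zero_le_one] at this
    exact h.congr_fun (fun t ht => by simp [quotBound, ht.2]) measurableSet_Ioc
  · exact (integrableOn_Ioi_rpow_of_lt (a := (-2 : ℝ)) (by norm_num) zero_lt_one).congr_fun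
      (fun t ht => by simp [quotBound, not_le.2 (show (1:ℝ) < t from ht)]) measurableSet_Ioi

theorem abs_mul_le_half_sq (a b : ℝ) : |a * b| ≤ (a ^ 2 + b ^ 2) / 2 := by
  rw [abs_le]; constructor <;> nlinarith [sq_nonneg (a + b), sq_nonneg (a - b)]

namespace HolderSq

variable {f : ℝ → ℝ} {A B : ℝ}

/-- For `t ≤ 1` the Hölder bound leaves the integrable singularity `t^(-1/2)`. For `t > 1`, `|f| / t
≤ (f² + t⁻²) / 2` needs square integrability only. -/
theorem abs_symmQuot_le (hf : HolderSq f A B) (x : ℝ) {t : ℝ} (ht : 0 < t) :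
    |symmQuot f x t| ≤ quotBound A t + (f (x - t) ^ 2 + f (x + t) ^ 2) / 2 := by
  unfold symmQuot quotBound
  split_ifs with h
  · have h1 := hf.holder (x - t) (x + t)
    have h2 : |x - t - (x + t)| = 2 * t := by
      rw [show x - t - (x + t) = -(2 * t) by ring, abs_neg, abs_of_pos (by linarith)]
    rw [h2, Real.sqrt_mul (by norm_num)] at h1
    have h3 : √t / t = t ^ (-(1/2) : ℝ) := by
      rw [Real.rpow_neg ht.le, ← Real.sqrt_eq_rpow, Real.sqrt_div_self', one_div]
    rw [abs_div, abs_of_pos ht]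
    have h4 : |f (x - t) - f (x + t)| / t ≤ A * (√2 * √t) / t := by gcongr
    have h5 : A * (√2 * √t) / t = A * √2 * t ^ (-(1/2) : ℝ) := by rw [← h3]; ring
    nlinarith [sq_nonneg (f (x - t)), sq_nonneg (f (x + t))]
  · have h1 := abs_mul_le_half_sq (f (x - t)) t⁻¹
    have h2 := abs_mul_le_half_sq (f (x + t)) t⁻¹
    have h3 : t ^ (-2 : ℝ) = t⁻¹ ^ 2 := by
      rw [Real.rpow_neg ht.le, inv_pow]; norm_cast
    have h4 : |(f (x - t) - f (x + t)) / t| ≤ |f (x - t) * t⁻¹| + |f (x + t) * t⁻¹| := by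
      rw [div_eq_mul_inv, sub_mul]; exact abs_sub _ _
    rw [h3]; linarith

theorem integrable_sq_sub (hf : HolderSq f A B) (x : ℝ) :
    Integrable (fun t => f (x - t) ^ 2) := hf.integrable_sq.comp_sub_left x

theorem integrable_sq_add (hf : HolderSq f A B) (x : ℝ) :
    Integrable (fun t => f (x + t) ^ 2) := hf.integrable_sq.comp_add_left x

theorem integrable_half_sq (hf : HolderSq f A B) (x : ℝ) :
    Integrable (fun t => (f (x - t) ^ 2 + f (x + t) ^ 2) / 2) :=
  ((hf.integrable_sq_sub x).add (hf.integrable_sq_add x)).div_const 2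

theorem integrableOn_bound (hf : HolderSq f A B) (x : ℝ) :
    IntegrableOn (fun t => quotBound A t + (f (x - t) ^ 2 + f (x + t) ^ 2) / 2) (Ioi 0) :=
  (integrableOn_quotBound A).add (hf.integrable_half_sq x).integrableOn

theorem continuousOn_symmQuot (hf : HolderSq f A B) (x : ℝ) :
    ContinuousOn (symmQuot f x) (Ioi 0) := by
  have := hf.continuous
  unfold symmQuot
  exact ContinuousOn.div (by fun_prop) (by fun_prop) fun t ht => (ne_of_gt ht)

theorem integrableOn_symmQuot (hf : HolderSq f A B) (x : ℝ) :
    IntegrableOn (symmQuot f x) (Ioi 0) := by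
  refine (hf.integrableOn_bound x).mono'
    ((hf.continuousOn_symmQuot x).aestronglyMeasurable measurableSet_Ioi) ?_
  filter_upwards [ae_restrict_mem measurableSet_Ioi] with t ht
  exact hf.abs_symmQuot_le x ht

/-- Translation invariance of `∫ f²` makes the bound independent of `x`. It also controls every
truncation, which supplies the domination in Tricomi's identity. -/
theorem integral_abs_symmQuot_le (hf : HolderSq f A B) (x : ℝ) :
    ∫ t in Ioi 0, |symmQuot f x t| ≤ (∫ t in Ioi 0, quotBound A t) + B := by
  calc ∫ t in Ioi 0, |symmQuot f x t|
      ≤ ∫ t in Ioi 0, (quotBound A t + (f (x - t) ^ 2 + f (x + t) ^ 2) / 2) := by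
        refine setIntegral_mono_on (hf.integrableOn_symmQuot x).abs (hf.integrableOn_bound x)
          measurableSet_Ioi fun t ht => hf.abs_symmQuot_le x ht
    _ = (∫ t in Ioi 0, quotBound A t) + ∫ t in Ioi 0, (f (x - t) ^ 2 + f (x + t) ^ 2) / 2 :=
        integral_add (integrableOn_quotBound A) (hf.integrable_half_sq x).integrableOn
    _ ≤ (∫ t in Ioi 0, quotBound A t) + B := by
        gcongr
        calc ∫ t in Ioi 0, (f (x - t) ^ 2 + f (x + t) ^ 2) / 2
            ≤ ∫ t, (f (x - t) ^ 2 + f (x + t) ^ 2) / 2 :=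
              setIntegral_le_integral (hf.integrable_half_sq x)
                (Eventually.of_forall fun t => by positivity)
          _ = ((∫ t, f (x - t) ^ 2) + ∫ t, f (x + t) ^ 2) / 2 := by
              rw [integral_div, integral_add (hf.integrable_sq_sub x) (hf.integrable_sq_add x)]
          _ = ∫ t, f t ^ 2 := by
              rw [integral_sub_left_eq_self (fun t => f t ^ 2),
                integral_add_left_eq_self (fun t => f t ^ 2)]; ring
          _ ≤ B := hf.sq_le

theorem abs_setIntegral_symmQuot_le (hf : HolderSq f A B) (x : ℝ) {ε : ℝ} (hε : 0 ≤ ε) :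
    |∫ t in Ioi ε, symmQuot f x t| ≤ (∫ t in Ioi 0, quotBound A t) + B := by
  refine (abs_integral_le_integral_abs).trans (le_trans ?_ (hf.integral_abs_symmQuot_le x))
  exact setIntegral_mono_set (hf.integrableOn_symmQuot x).abs
    (Eventually.of_forall fun t => abs_nonneg _) (Ioi_subset_Ioi hε).eventuallyLE

theorem measurableSet_lt_abs_sub (x ε : ℝ) : MeasurableSet {y : ℝ | ε < |x - y|} :=
  measurableSet_lt measurable_const (by fun_prop)

theorem integrable_sq_kernel {ε : ℝ} (hε : 0 < ε) (x : ℝ) :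
    IntegrableOn (fun y => ((x - y)⁻¹) ^ 2) {y : ℝ | ε < |x - y|} := by
  have h1 : IntegrableOn (fun t : ℝ => t⁻¹ ^ 2) (Ioi ε) :=
    (integrableOn_Ioi_rpow_of_lt (a := (-2 : ℝ)) (by norm_num) hε).congr_fun
      (fun t ht => by
        dsimp only
        rw [Real.rpow_neg (hε.trans ht).le, inv_pow]; norm_cast) measurableSet_Ioi
  have h2 : IntegrableOn (fun t : ℝ => t⁻¹ ^ 2) (Iio (-ε)) := by
    have := h1.comp_neg
    simpa using this
  have h3 : IntegrableOn (fun t : ℝ => t⁻¹ ^ 2) {t : ℝ | ε < |t|} := by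
    have : {t : ℝ | ε < |t|} = Iio (-ε) ∪ Ioi ε := by
      ext t; simp only [mem_ofPred_eq, lt_abs, mem_union, mem_Iio, mem_Ioi]
      constructor <;> rintro (h | h) <;> first | (left; linarith) | (right; linarith)
    rw [this]; exact h2.union h1
  have hm : MeasurableSet {t : ℝ | ε < |t|} := measurableSet_lt measurable_const (by fun_prop)
  rw [← integrable_indicator_iff hm] at h3
  rw [← integrable_indicator_iff (measurableSet_lt_abs_sub x ε)]
  exact h3.comp_sub_left x

theorem integrableOn_trunc (hf : HolderSq f A B) {ε : ℝ} (hε : 0 < ε) (x : ℝ) :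
    IntegrableOn (fun y => f y / (x - y)) {y : ℝ | ε < |x - y|} := by
  refine ((hf.integrable_sq.integrableOn.add (integrable_sq_kernel hε x)).div_const 2).mono'
    ?_ (Eventually.of_forall fun y => ?_)
  · exact (hf.continuous.measurable.div (by fun_prop)).aestronglyMeasurable
  · exact abs_mul_le_half_sq (f y) (x - y)⁻¹

/-- Fold the half-lines `y < x - ε` and `y > x + ε` together by `y = x ∓ t`. -/
theorem trunc_eq (hf : HolderSq f A B) {ε : ℝ} (hε : 0 < ε) (x : ℝ) :
    ∫ y in {y : ℝ | ε < |x - y|}, f y / (x - y) = ∫ t in Ioi ε, symmQuot f x t := by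
  have hI := hf.integrableOn_trunc hε x
  have hset : {y : ℝ | ε < |x - y|} = Iio (x - ε) ∪ Ioi (x + ε) := by
    ext t; simp only [mem_ofPred_eq, lt_abs, mem_union, mem_Iio, mem_Ioi]
    constructor <;> rintro (h | h) <;> first | (left; linarith) | (right; linarith)
  rw [hset] at hI ⊢
  have hdisj : Disjoint (Iio (x - ε)) (Ioi (x + ε)) := by
    rw [Set.disjoint_left]; intro t h1 h2
    simp only [mem_Iio, mem_Ioi] at h1 h2; linarith
  have hL := hI.mono_set subset_union_left
  have hR := hI.mono_set subset_union_right
  rw [setIntegral_union hdisj measurableSet_Ioi hL hR]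
  have e1 : (∫ y in Iio (x - ε), f y / (x - y)) = ∫ t in Ioi ε, f (x - t) / t := by
    rw [← integral_indicator measurableSet_Iio, ← integral_indicator measurableSet_Ioi,
      ← integral_sub_left_eq_self _ volume x]
    congr 1; ext t
    simp only [indicator, mem_Iio, mem_Ioi, sub_lt_sub_iff_left, sub_sub_cancel]
  have e2 : (∫ y in Ioi (x + ε), f y / (x - y)) = ∫ t in Ioi ε, -(f (x + t) / t) := by
    rw [← integral_indicator measurableSet_Ioi, ← integral_indicator measurableSet_Ioi,
      ← integral_add_left_eq_self _ x]
    congr 1; ext t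
    simp only [indicator, mem_Ioi, add_lt_add_iff_left]
    split_ifs
    · rw [show x - (x + t) = -t by ring, div_neg]
    · rfl
  have i1 : IntegrableOn (fun t => f (x - t) / t) (Ioi ε) := by
    rw [← integrable_indicator_iff measurableSet_Iio] at hL
    rw [← integrable_indicator_iff measurableSet_Ioi]
    refine (hL.comp_sub_left x).congr (Eventually.of_forall fun t => ?_)
    simp only [indicator, mem_Iio, mem_Ioi, sub_lt_sub_iff_left, sub_sub_cancel]
  have i2 : IntegrableOn (fun t => -(f (x + t) / t)) (Ioi ε) := by
    rw [← integrable_indicator_iff measurableSet_Ioi] at hR ⊢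
    refine (hR.comp_add_left x).congr (Eventually.of_forall fun t => ?_)
    simp only [indicator, mem_Ioi, add_lt_add_iff_left]
    split_ifs
    · rw [show x - (x + t) = -t by ring, div_neg]
    · rfl
  rw [e1, e2, ← integral_add i1 i2]
  congr 1; ext t; simp only [symmQuot]; ring

theorem tendsto_trunc (hf : HolderSq f A B) (x : ℝ) :
    Tendsto (fun ε : ℝ => (1 / Real.pi) * ∫ y in {y : ℝ | ε < |x - y|}, f y / (x - y))
      (𝓝[>] 0) (𝓝 ((1 / Real.pi) * ∫ t in Ioi 0, symmQuot f x t)) := by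
  refine Tendsto.const_mul _ ?_
  have h1 : Tendsto (fun ε : ℝ => ∫ t in Ioi ε, symmQuot f x t) (𝓝[>] 0)
      (𝓝 (∫ t in Ioi 0, symmQuot f x t)) := by
    have hc : AECover (volume.restrict (Ioi (0:ℝ))) (𝓝[>] (0:ℝ)) fun ε => Ioi ε :=
      aecover_Ioi_of_Ioi (tendsto_id.mono_left nhdsWithin_le_nhds)
    refine (hc.integral_tendsto_of_countably_generated (hf.integrableOn_symmQuot x)).congr' ?_
    filter_upwards [self_mem_nhdsWithin] with ε hε
    rw [Measure.restrict_restrict measurableSet_Ioi,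
      inter_eq_left.2 (Ioi_subset_Ioi (le_of_lt hε))]
  refine h1.congr' ?_
  filter_upwards [self_mem_nhdsWithin] with ε hε
  rw [hf.trunc_eq hε]

/-- The principal value limit exists, so `limUnder` is a genuine limit and not a default value. -/
theorem hilbertTransform_eq (hf : HolderSq f A B) (x : ℝ) :
    hilbertTransform f x = (1 / Real.pi) * ∫ t in Ioi 0, symmQuot f x t :=
  (hf.tendsto_trunc x).limUnder_eq

theorem abs_hilbertTransform_le (hf : HolderSq f A B) (x : ℝ) :
    |hilbertTransform f x| ≤ (1 / Real.pi) * ((∫ t in Ioi 0, quotBound A t) + B) := by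
  rw [hf.hilbertTransform_eq, abs_mul, abs_of_pos (by positivity)]
  gcongr
  exact hf.abs_setIntegral_symmQuot_le x le_rfl

end HolderSq

/-! ### Continuity of the Hilbert transform and its behaviour under dilation. -/

theorem inv_sq_le_of_one_lt_abs {x₀ x y : ℝ} (hx : |x - x₀| < 1 / 2) (h : 1 < |x - y|) :
    ((x - y)⁻¹) ^ 2 ≤ 4 * (1 + (y - x₀) ^ 2)⁻¹ := by
  have h1 : 1 < (x - y) ^ 2 := by rw [← sq_abs]; nlinarith
  have h2 : (x - x₀) ^ 2 < 1 / 4 := by rw [← sq_abs]; nlinarith [abs_nonneg (x - x₀)]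
  rw [inv_pow, ← div_eq_mul_inv, inv_eq_one_div, div_le_div_iff₀ (by linarith) (by positivity)]
  nlinarith [sq_nonneg ((x - y) + (x - x₀))]

namespace HolderSq

variable {f : ℝ → ℝ} {A B : ℝ}

theorem continuous_setIntegral_Ioc (hf : HolderSq f A B) :
    Continuous fun x => ∫ t in Ioc 0 1, symmQuot f x t := by
  refine continuous_of_dominated (bound := fun t => A * √2 * t ^ (-(1/2) : ℝ)) (fun x => ?_)
    (fun x => ?_) ?_ ?_
  · exact ((hf.continuousOn_symmQuot x).mono Ioc_subset_Ioi_self).aestronglyMeasurable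
      measurableSet_Ioc
  · filter_upwards [ae_restrict_mem measurableSet_Ioc] with t ht
    have h1 := hf.holder (x - t) (x + t)
    have h2 : |x - t - (x + t)| = 2 * t := by
      rw [show x - t - (x + t) = -(2 * t) by ring, abs_neg, abs_of_pos (by linarith [ht.1])]
    rw [h2, Real.sqrt_mul (by norm_num)] at h1
    have h3 : √t / t = t ^ (-(1/2) : ℝ) := by
      rw [Real.rpow_neg ht.1.le, ← Real.sqrt_eq_rpow, Real.sqrt_div_self', one_div]
    rw [Real.norm_eq_abs, symmQuot, abs_div, abs_of_pos ht.1, ← h3, mul_div_assoc', mul_assoc]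
    have := ht.1
    gcongr
  · exact ((integrableOn_quotBound A).mono_set Ioc_subset_Ioi_self).congr_fun
      (fun t ht => by simp [quotBound, ht.2]) measurableSet_Ioc
  · refine Eventually.of_forall fun t => ?_
    have := hf.continuous
    unfold symmQuot
    fun_prop

/-- In the variable `y` only the kernel moves with `x`, so one dominating function serves all `x`
near `x₀`; translates of `f²` would not allow this. The jump of the cutoff matters only at `y = x₀ ±
1`, a null set. -/
theorem continuousAt_trunc_one (hf : HolderSq f A B) (x₀ : ℝ) :
    ContinuousAt (fun x => ∫ y in {y : ℝ | 1 < |x - y|}, f y / (x - y)) x₀ := by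
  have key : (fun x => ∫ y in {y : ℝ | 1 < |x - y|}, f y / (x - y)) =
      fun x => ∫ y, {y : ℝ | 1 < |x - y|}.indicator (fun y => f y / (x - y)) y := by
    ext x; rw [integral_indicator (measurableSet_lt_abs_sub x 1)]
  rw [key]
  refine continuousAt_of_dominated
    (bound := fun y => (f y ^ 2 + 4 * (1 + (y - x₀) ^ 2)⁻¹) / 2) ?_ ?_ ?_ ?_
  · refine Eventually.of_forall fun x => ?_
    exact (((hf.continuous.measurable.div (by fun_prop))).indicator
      (measurableSet_lt_abs_sub x 1)).aestronglyMeasurable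
  · have : ∀ᶠ x in 𝓝 x₀, |x - x₀| < 1 / 2 := by
      simpa [Real.dist_eq] using Metric.eventually_nhds_iff_ball.2
        ⟨1/2, by norm_num, fun y hy => by simpa [Real.dist_eq] using hy⟩
    filter_upwards [this] with x hx
    refine Eventually.of_forall fun y => ?_
    by_cases hy : 1 < |x - y|
    · rw [indicator_of_mem (show y ∈ {y : ℝ | 1 < |x - y|} from hy)]
      have h1 := abs_mul_le_half_sq (f y) (x - y)⁻¹
      have h2 := inv_sq_le_of_one_lt_abs hx hy
      rw [Real.norm_eq_abs, div_eq_mul_inv]; linarith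
    · rw [indicator_of_notMem (show y ∉ {y : ℝ | 1 < |x - y|} from hy), norm_zero]
      positivity
  · exact (hf.integrable_sq.add
      ((integrable_inv_one_add_sq.comp_sub_right x₀).const_mul 4)).div_const 2
  · have h1 : ∀ᵐ y : ℝ, y ≠ x₀ - 1 := by simp [ae_iff, measure_singleton]
    have h2 : ∀ᵐ y : ℝ, y ≠ x₀ + 1 := by simp [ae_iff, measure_singleton]
    filter_upwards [h1, h2] with y hy1 hy2
    have hne : |x₀ - y| ≠ 1 := by
      intro h
      rcases (abs_eq zero_le_one).1 h with h | h
      · exact hy1 (by linarith)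
      · exact hy2 (by linarith)
    have hc : ContinuousAt (fun x : ℝ => |x - y|) x₀ := by fun_prop
    rcases lt_or_gt_of_ne hne with h | h
    · refine (continuousAt_const (y := (0:ℝ))).congr ?_
      filter_upwards [hc.eventually_lt_const h] with x hx
      rw [indicator_of_notMem (show y ∉ {y : ℝ | 1 < |x - y|} from not_lt.2 hx.le)]
    · have h0 : x₀ - y ≠ 0 := by intro h0; rw [h0] at h; simp at h; linarith
      refine (ContinuousAt.div (f := fun _ => f y) (g := fun x => x - y)
        continuousAt_const (by fun_prop) h0).congr ?_
      filter_upwards [hc.eventually_const_lt h] with x hx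
      rw [indicator_of_mem (show y ∈ {y : ℝ | 1 < |x - y|} from hx), Pi.div_apply]

theorem continuous_hilbertTransform (hf : HolderSq f A B) : Continuous (hilbertTransform f) := by
  have : hilbertTransform f = fun x => (1 / Real.pi) * ((∫ t in Ioc 0 1, symmQuot f x t) +
      ∫ y in {y : ℝ | 1 < |x - y|}, f y / (x - y)) := by
    ext x
    rw [hf.hilbertTransform_eq, hf.trunc_eq one_pos, ← Ioc_union_Ioi_eq_Ioi zero_le_one,
      setIntegral_union (Ioc_disjoint_Ioi le_rfl) measurableSet_Ioi
        ((hf.integrableOn_symmQuot x).mono_set Ioc_subset_Ioi_self)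
        ((hf.integrableOn_symmQuot x).mono_set (Ioi_subset_Ioi zero_le_one))]
  rw [this]
  exact continuous_const.mul (hf.continuous_setIntegral_Ioc.add
    (continuous_iff_continuousAt.2 hf.continuousAt_trunc_one))

theorem hilbertTransform_comp_mul (hf : HolderSq f A B) {A' B' L : ℝ} (hL : 0 < L)
    (hfL : HolderSq (fun x => f (L * x)) A' B') (x : ℝ) :
    hilbertTransform (fun x => f (L * x)) x = hilbertTransform f (L * x) := by
  rw [hf.hilbertTransform_eq, hfL.hilbertTransform_eq]
  congr 1
  have h := integral_comp_mul_left_Ioi (symmQuot f (L * x)) 0 hL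
  rw [mul_zero] at h
  have h2 : ∫ t in Ioi 0, symmQuot f (L * x) t
      = L * ∫ t in Ioi 0, symmQuot f (L * x) (L * t) := by
    rw [h, smul_eq_mul, mul_inv_cancel_left₀ hL.ne']
  rw [h2, ← integral_const_mul]
  congr 1; ext t
  simp only [symmQuot, mul_sub, mul_add]
  field_simp

theorem comp_mul (hf : HolderSq f A B) {L : ℝ} (hL : 0 < L) :
    HolderSq (fun x => f (L * x)) (A * √L) (L⁻¹ * B) where
  continuous := hf.continuous.comp (by fun_prop)
  integrable_sq := hf.integrable_sq.comp_mul_left' hL.ne'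
  holder x y := by
    have := hf.holder (L * x) (L * y)
    rwa [← mul_sub, abs_mul, abs_of_pos hL, Real.sqrt_mul hL.le, ← mul_assoc] at this
  sq_le := by
    rw [Measure.integral_comp_mul_left (fun x => f x ^ 2) L, abs_of_pos (by positivity),
      smul_eq_mul]
    gcongr
    exact hf.sq_le

theorem mono (hf : HolderSq f A B) {A' B' : ℝ} (hA : A ≤ A') (hB : B ≤ B') :
    HolderSq f A' B' where
  continuous := hf.continuous
  integrable_sq := hf.integrable_sq
  holder x y := (hf.holder x y).trans (by gcongr)
  sq_le := hf.sq_le.trans hB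

end HolderSq

/-! ### The Cauchy transform and Tricomi's identity. -/

/-- The Cauchy transform of `f` in the upper half plane, whose boundary values are `H f - i f`. -/
noncomputable def cauchyTransform (f : ℝ → ℝ) (z : ℂ) : ℂ :=
  (1 / Real.pi : ℂ) * ∫ y : ℝ, (f y : ℂ) / (z - y)

theorem sub_ofReal_ne_zero {z : ℂ} (hz : 0 < z.im) (y : ℝ) : z - y ≠ 0 := by
  intro h
  have := congrArg Complex.im h
  simp at this; linarith

theorem norm_inv_sub_ofReal_sq (z : ℂ) (y : ℝ) :
    ‖(z - y)⁻¹‖ ^ 2 = ((z.re - y) ^ 2 + z.im ^ 2)⁻¹ := by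
  rw [norm_inv, inv_pow, ← Complex.normSq_eq_norm_sq, Complex.normSq_apply]
  simp [sq]

theorem integrable_norm_inv_sub_ofReal_sq {z : ℂ} (hz : 0 < z.im) :
    Integrable (fun y : ℝ => ‖(z - y)⁻¹‖ ^ 2) := by
  have h := ((integrable_inv_one_add_sq.comp_div hz.ne').comp_sub_left z.re).const_mul
    ((z.im ^ 2)⁻¹)
  refine h.congr (Eventually.of_forall fun y => ?_)
  dsimp only
  rw [norm_inv_sub_ofReal_sq, ← mul_inv]; congr 1; field_simp; ring

namespace HolderSq

variable {f : ℝ → ℝ} {A B : ℝ} {z : ℂ}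

theorem norm_div_sub_le (f : ℝ → ℝ) (z : ℂ) (y : ℝ) :
    ‖(f y : ℂ) / (z - y)‖ ≤ (f y ^ 2 + ‖(z - y)⁻¹‖ ^ 2) / 2 := by
  have := abs_mul_le_half_sq |f y| ‖(z - y)⁻¹‖
  rw [abs_of_nonneg (by positivity), sq_abs] at this
  rwa [div_eq_mul_inv, norm_mul, Complex.norm_real, Real.norm_eq_abs]

theorem continuous_div_sub (hf : HolderSq f A B) (hz : 0 < z.im) :
    Continuous fun y : ℝ => (f y : ℂ) / (z - y) := by
  have := hf.continuous
  exact Continuous.div (by fun_prop) (by fun_prop) (sub_ofReal_ne_zero hz)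

theorem integrable_div_sub (hf : HolderSq f A B) (hz : 0 < z.im) :
    Integrable fun y : ℝ => (f y : ℂ) / (z - y) :=
  ((hf.integrable_sq.add (integrable_norm_inv_sub_ofReal_sq hz)).div_const 2).mono'
    (hf.continuous_div_sub hz).aestronglyMeasurable
    (Eventually.of_forall fun y => norm_div_sub_le f z y)

theorem integrable_truncKernel {ε : ℝ} (hε : 0 < ε) :
    Integrable ({s : ℝ | ε < |s|}.indicator fun s => s⁻¹ ^ 2) := by
  have h := integrable_sq_kernel hε 0
  rw [← integrable_indicator_iff (measurableSet_lt_abs_sub 0 ε)] at h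
  have h2 := h.comp_neg
  refine h2.congr (Eventually.of_forall fun s => ?_)
  simp [indicator]

/-- The truncated double kernel of the product of the Cauchy and Hilbert kernels. -/
noncomputable def doubleKernel (f : ℝ → ℝ) (z : ℂ) (ε : ℝ) (p : ℝ × ℝ) : ℂ :=
  {p : ℝ × ℝ | ε < |p.1 - p.2|}.indicator
    (fun p => (f p.1 : ℂ) / (z - p.1) * ((f p.2 / (p.1 - p.2) : ℝ) : ℂ)) p

theorem measurableSet_offDiag (ε : ℝ) : MeasurableSet {p : ℝ × ℝ | ε < |p.1 - p.2|} :=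
  measurableSet_lt measurable_const (by fun_prop)

/-- Bounding `|f y' / (y - y')|` by half a sum of squares leaves a product of integrable functions
and a convolution integrand, both integrable on the plane. -/
theorem integrable_doubleKernel (hf : HolderSq f A B) (hz : 0 < z.im) {ε : ℝ} (hε : 0 < ε) :
    Integrable (doubleKernel f z ε) (volume.prod volume) := by
  have hK := hf.integrable_div_sub hz
  have h1 : Integrable (fun p : ℝ × ℝ => ‖(f p.1 : ℂ) / (z - p.1)‖ * f p.2 ^ 2)
      (volume.prod volume) := hK.norm.mul_prod hf.integrable_sq
  have h2 : Integrable (fun p : ℝ × ℝ => ‖(f p.1 : ℂ) / (z - p.1)‖ *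
      {s : ℝ | ε < |s|}.indicator (fun s => s⁻¹ ^ 2) (p.2 - p.1)) (volume.prod volume) :=
    (hK.norm.convolution_integrand (ContinuousLinearMap.mul ℝ ℝ)
      (integrable_truncKernel hε)).swap
  refine ((h1.add h2).div_const 2).mono' ?_ (Eventually.of_forall fun p => ?_)
  · have := hf.continuous.measurable
    have : Measurable fun p : ℝ × ℝ =>
        (f p.1 : ℂ) / (z - p.1) * ((f p.2 / (p.1 - p.2) : ℝ) : ℂ) := by fun_prop
    exact (this.indicator (measurableSet_offDiag ε)).aestronglyMeasurable
  · by_cases hp : ε < |p.1 - p.2|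
    · have hp' : ε < |p.2 - p.1| := by rwa [abs_sub_comm]
      rw [doubleKernel, indicator_of_mem (show p ∈ {p : ℝ × ℝ | ε < |p.1 - p.2|} from hp)]
      dsimp only [Pi.add_apply]
      rw [indicator_of_mem (show p.2 - p.1 ∈ {s : ℝ | ε < |s|} from hp'), norm_mul,
        ← mul_add, mul_div_assoc]
      gcongr
      have h := abs_mul_le_half_sq (f p.2) (p.1 - p.2)⁻¹
      rw [Complex.norm_real, Real.norm_eq_abs, div_eq_mul_inv]
      have : (p.1 - p.2)⁻¹ ^ 2 = (p.2 - p.1)⁻¹ ^ 2 := by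
        rw [inv_pow, inv_pow]; congr 1; ring
      rwa [this] at h
    · rw [doubleKernel, indicator_of_notMem (show p ∉ {p : ℝ × ℝ | ε < |p.1 - p.2|} from hp),
        norm_zero]
      have : 0 ≤ {s : ℝ | ε < |s|}.indicator (fun s => s⁻¹ ^ 2) (p.2 - p.1) :=
        indicator_nonneg (fun s _ => by positivity) _
      simp only [Pi.add_apply]
      positivity

/-- Partial fractions: `1/((z-a)(a-b)) + 1/((z-b)(b-a)) = 1/((z-a)(z-b))`. Symmetrization removes
the singularity on the diagonal. -/
theorem doubleKernel_add_swap (hz : 0 < z.im) {ε : ℝ} (hε : 0 < ε) (p : ℝ × ℝ) :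
    doubleKernel f z ε p + doubleKernel f z ε p.swap =
      {p : ℝ × ℝ | ε < |p.1 - p.2|}.indicator
        (fun p => (f p.1 : ℂ) / (z - p.1) * ((f p.2 : ℂ) / (z - p.2))) p := by
  by_cases hp : ε < |p.1 - p.2|
  · have hp' : ε < |p.2 - p.1| := by rwa [abs_sub_comm]
    rw [doubleKernel, doubleKernel,
      indicator_of_mem (show p ∈ {p : ℝ × ℝ | ε < |p.1 - p.2|} from hp),
      indicator_of_mem (show p.swap ∈ {p : ℝ × ℝ | ε < |p.1 - p.2|} from hp'),
      indicator_of_mem (show p ∈ {p : ℝ × ℝ | ε < |p.1 - p.2|} from hp)]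
    have h0 : p.1 - p.2 ≠ 0 := by intro h; rw [h, abs_zero] at hp; linarith
    have h1 := sub_ofReal_ne_zero hz p.1
    have h2 := sub_ofReal_ne_zero hz p.2
    have h3 : (p.1 : ℂ) - p.2 ≠ 0 := by exact_mod_cast h0
    have h4 : (p.2 : ℂ) - p.1 ≠ 0 := by rw [← neg_sub]; exact neg_ne_zero.2 h3
    simp only [Prod.fst_swap, Prod.snd_swap]
    push_cast
    rw [show (p.2 : ℂ) - p.1 = -(p.1 - p.2) by ring]
    field_simp
    ring
  · have hp' : ¬ ε < |p.2 - p.1| := by rwa [abs_sub_comm]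
    rw [doubleKernel, doubleKernel,
      indicator_of_notMem (show p ∉ {p : ℝ × ℝ | ε < |p.1 - p.2|} from hp),
      indicator_of_notMem (show p.swap ∉ {p : ℝ × ℝ | ε < |p.1 - p.2|} from hp'),
      indicator_of_notMem (show p ∉ {p : ℝ × ℝ | ε < |p.1 - p.2|} from hp), add_zero]

theorem integral_div_sub_mul_trunc (hf : HolderSq f A B) (hz : 0 < z.im) {ε : ℝ} (hε : 0 < ε) :
    ∫ y : ℝ, (f y : ℂ) / (z - y) * ((∫ t in Ioi ε, symmQuot f y t : ℝ) : ℂ) =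
      (1 / 2) * ∫ p : ℝ × ℝ, {p : ℝ × ℝ | ε < |p.1 - p.2|}.indicator
        (fun p => (f p.1 : ℂ) / (z - p.1) * ((f p.2 : ℂ) / (z - p.2))) p
          ∂(volume.prod volume) := by
  have hI := hf.integrable_doubleKernel hz hε
  have h1 : ∫ p, doubleKernel f z ε p ∂(volume.prod volume) =
      ∫ y : ℝ, (f y : ℂ) / (z - y) * ((∫ t in Ioi ε, symmQuot f y t : ℝ) : ℂ) := by
    rw [integral_prod _ hI]
    refine integral_congr_ae (Eventually.of_forall fun y => ?_)
    dsimp only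
    rw [← hf.trunc_eq hε, ← integral_complex_ofReal, ← integral_const_mul,
      ← integral_indicator (measurableSet_lt_abs_sub y ε)]
    rfl
  rw [← h1]
  simp_rw [← doubleKernel_add_swap hz hε]
  have h3 : ∫ p : ℝ × ℝ, (doubleKernel f z ε p + doubleKernel f z ε p.swap)
      ∂(volume.prod volume) = (∫ p, doubleKernel f z ε p ∂(volume.prod volume)) +
        ∫ p : ℝ × ℝ, doubleKernel f z ε p.swap ∂(volume.prod volume) :=
    integral_add hI hI.swap
  have h2 : ∫ p : ℝ × ℝ, doubleKernel f z ε p.swap ∂(volume.prod volume) =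
      ∫ p, doubleKernel f z ε p ∂(volume.prod volume) :=
    integral_prod_swap (doubleKernel f z ε)
  rw [h3, h2]; ring

theorem ae_prod_ne : ∀ᵐ p : ℝ × ℝ ∂(volume.prod volume), p.1 ≠ p.2 := by
  have hm : MeasurableSet {p : ℝ × ℝ | p.1 = p.2} :=
    measurableSet_eq_fun measurable_fst measurable_snd
  have : (volume.prod volume : Measure (ℝ × ℝ)) {p : ℝ × ℝ | p.1 = p.2} = 0 := by
    rw [Measure.measure_prod_null hm]
    refine Eventually.of_forall fun x => ?_
    have : (Prod.mk x ⁻¹' {p : ℝ × ℝ | p.1 = p.2}) = {x} := by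
      ext y; simp [eq_comm]
    simp [this]
  rw [ae_iff]
  simpa using this

/-- Tricomi's identity `H(f Hf) = ((Hf)² - f²) / 2`, in the upper half plane. -/
theorem cauchyTransform_hilbert_mul (hf : HolderSq f A B) (hz : 0 < z.im) :
    cauchyTransform (fun y => hilbertTransform f y * f y) z = cauchyTransform f z ^ 2 / 2 := by
  have hK := hf.integrable_div_sub hz
  set u : ℕ → ℝ := fun n => 1 / ((n : ℝ) + 1) with hu
  have hu0 : ∀ n, 0 < u n := fun n => by positivity
  have hulim : Tendsto u atTop (𝓝 0) := tendsto_one_div_add_atTop_nhds_zero_nat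
  have hulim' : Tendsto u atTop (𝓝[>] 0) :=
    tendsto_nhdsWithin_iff.2 ⟨hulim, Eventually.of_forall hu0⟩
  -- Let the truncation tend to zero on both sides. Here truncated Hilbert integrals are bounded
  -- uniformly in `y` and `n`, so a multiple of the Cauchy integrand dominates; on the other side
  -- only the null diagonal is lost.
  have hL : Tendsto
      (fun n => ∫ y : ℝ, (f y : ℂ) / (z - y) * ((∫ t in Ioi (u n), symmQuot f y t : ℝ) : ℂ))
      atTop (𝓝 (∫ y : ℝ, (f y : ℂ) / (z - y) * ((Real.pi * hilbertTransform f y : ℝ) : ℂ))) := by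
    have hlim : ∀ y, Tendsto (fun n => ∫ t in Ioi (u n), symmQuot f y t) atTop
        (𝓝 (Real.pi * hilbertTransform f y)) := by
      intro y
      have h := ((hf.tendsto_trunc y).comp hulim').const_mul Real.pi
      rw [← hf.hilbertTransform_eq] at h
      refine h.congr fun n => ?_
      simp only [Function.comp]
      rw [hf.trunc_eq (hu0 n)]
      field_simp
    refine tendsto_integral_of_dominated_convergence
      (fun y : ℝ => ‖(f y : ℂ) / (z - y)‖ * ((∫ t in Ioi 0, quotBound A t) + B))
      (fun n => ?_) (hK.norm.mul_const _) (fun n => Eventually.of_forall fun y => ?_)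
      (Eventually.of_forall fun y => ?_)
    · refine (hf.continuous_div_sub hz).aestronglyMeasurable.mul ?_
      refine Complex.continuous_ofReal.comp_aestronglyMeasurable ?_
      have hm : StronglyMeasurable (Function.uncurry fun y y' : ℝ =>
          {y' : ℝ | u n < |y - y'|}.indicator (fun y' => f y' / (y - y')) y') := by
        have := hf.continuous.measurable
        have : Measurable fun p : ℝ × ℝ => f p.2 / (p.1 - p.2) := by fun_prop
        exact (this.indicator (measurableSet_offDiag (u n))).stronglyMeasurable
      have h := hm.integral_prod_right (ν := volume)
      refine h.aestronglyMeasurable.congr (Eventually.of_forall fun y => ?_)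
      dsimp only
      rw [integral_indicator (measurableSet_lt_abs_sub y (u n)), hf.trunc_eq (hu0 n)]
    · rw [norm_mul, Complex.norm_real]
      gcongr
      exact hf.abs_setIntegral_symmQuot_le y (hu0 n).le
    · exact Tendsto.const_mul _ ((Complex.continuous_ofReal.tendsto _).comp (hlim y))
  have hR : Tendsto (fun n => (1 / 2 : ℂ) *
      ∫ p : ℝ × ℝ, {p : ℝ × ℝ | u n < |p.1 - p.2|}.indicator
        (fun p => (f p.1 : ℂ) / (z - p.1) * ((f p.2 : ℂ) / (z - p.2))) p
          ∂(volume.prod volume)) atTop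
      (𝓝 ((1 / 2 : ℂ) * ∫ p : ℝ × ℝ, (f p.1 : ℂ) / (z - p.1) * ((f p.2 : ℂ) / (z - p.2))
          ∂(volume.prod volume))) := by
    have hKK := hK.mul_prod hK
    refine Tendsto.const_mul _ (tendsto_integral_of_dominated_convergence
      (fun p : ℝ × ℝ => ‖(f p.1 : ℂ) / (z - p.1) * ((f p.2 : ℂ) / (z - p.2))‖)
      (fun n => ?_) hKK.norm (fun n => Eventually.of_forall fun p => ?_) ?_)
    · exact hKK.aestronglyMeasurable.indicator (measurableSet_offDiag (u n))
    · exact norm_indicator_le_norm_self _ _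
    · filter_upwards [ae_prod_ne] with p hp
      have hp' : 0 < |p.1 - p.2| := abs_pos.2 (sub_ne_zero.2 hp)
      refine tendsto_const_nhds.congr' ?_
      filter_upwards [hulim.eventually_lt_const hp'] with n hn
      rw [indicator_of_mem (show p ∈ {p : ℝ × ℝ | u n < |p.1 - p.2|} from hn)]
  have hEq := tendsto_nhds_unique hL
    (hR.congr fun n => (hf.integral_div_sub_mul_trunc hz (hu0 n)).symm)
  rw [integral_prod_mul (fun y : ℝ => (f y : ℂ) / (z - y)) (fun y : ℝ => (f y : ℂ) / (z - y))]
    at hEq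
  have hpi : (Real.pi : ℂ) ≠ 0 := by exact_mod_cast Real.pi_ne_zero
  have hH : ∫ y : ℝ, (f y : ℂ) / (z - y) * ((Real.pi * hilbertTransform f y : ℝ) : ℂ) =
      Real.pi * ∫ y : ℝ, ((hilbertTransform f y * f y : ℝ) : ℂ) / (z - y) := by
    rw [← integral_const_mul]
    congr 1; ext y; push_cast; ring
  rw [hH] at hEq
  unfold cauchyTransform
  have h3 : ∫ y : ℝ, ((hilbertTransform f y * f y : ℝ) : ℂ) / (z - y) = (1 / Real.pi) *
      (1 / 2 * ((∫ y : ℝ, (f y : ℂ) / (z - y)) * ∫ y : ℝ, (f y : ℂ) / (z - y))) := by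
    rw [← hEq]; field_simp
  rw [h3]; ring

end HolderSq

/-! ### Boundary values of the Cauchy transform. -/

namespace HolderSq

variable {f : ℝ → ℝ} {A B : ℝ} {z : ℂ}

/-- Average `f x² ≤ 2 f y² + 2 (f x - f y)²` over `y` in `[x, x + 1]`. -/
theorem sq_le_of_holder (hf : HolderSq f A B) (x : ℝ) : f x ^ 2 ≤ 2 * B + 2 * A ^ 2 := by
  have hA : 0 ≤ A := by
    have := (abs_nonneg _).trans (hf.holder 0 1)
    simpa using this
  have h1 : ∀ y ∈ Icc x (x + 1), f x ^ 2 ≤ 2 * f y ^ 2 + 2 * A ^ 2 := by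
    intro y hy
    have h := hf.holder x y
    have h2 : √|x - y| ≤ 1 := by
      refine Real.sqrt_le_one.2 (abs_le.2 ⟨?_, ?_⟩) <;> linarith [hy.1, hy.2]
    have h3 : |f x - f y| ≤ A := h.trans (by nlinarith)
    have h4 : (f x - f y) ^ 2 ≤ A ^ 2 := by rw [← sq_abs]; gcongr
    nlinarith [sq_nonneg (f x - 2 * f y)]
  have h2 : ∫ y in Icc x (x + 1), f x ^ 2 ≤ ∫ y in Icc x (x + 1), (2 * f y ^ 2 + 2 * A ^ 2) := by
    refine setIntegral_mono_on continuous_const.integrableOn_Icc ?_ measurableSet_Icc h1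
    exact (hf.integrable_sq.integrableOn.const_mul 2).add continuous_const.integrableOn_Icc
  rw [integral_add (hf.integrable_sq.integrableOn.const_mul 2) continuous_const.integrableOn_Icc, integral_const_mul] at h2
  simp only [integral_const, measureReal_restrict_apply_univ, Real.volume_real_Icc,
    smul_eq_mul] at h2
  rw [show x + 1 - x = 1 by ring, max_eq_left zero_le_one] at h2
  have h3 : ∫ y in Icc x (x + 1), f y ^ 2 ≤ ∫ y, f y ^ 2 :=
    setIntegral_le_integral hf.integrable_sq (Eventually.of_forall fun y => sq_nonneg _)
  linarith [hf.sq_le]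

theorem div_sub_re (f : ℝ → ℝ) (z : ℂ) (y : ℝ) : ((f y : ℂ) / (z - y)).re =
    f y * (z.re - y) / ((z.re - y) ^ 2 + z.im ^ 2) := by
  rw [Complex.div_re, Complex.normSq_apply]
  simp [sq]

theorem div_sub_im (f : ℝ → ℝ) (z : ℂ) (y : ℝ) : ((f y : ℂ) / (z - y)).im =
    -(f y * z.im / ((z.re - y) ^ 2 + z.im ^ 2)) := by
  rw [Complex.div_im, Complex.normSq_apply]
  simp [sq]

theorem integrable_re (hf : HolderSq f A B) (hz : 0 < z.im) :
    Integrable fun y : ℝ => f y * (z.re - y) / ((z.re - y) ^ 2 + z.im ^ 2) :=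
  (hf.integrable_div_sub hz).re.congr (Eventually.of_forall fun y => div_sub_re f z y)

theorem cauchyTransform_re (hf : HolderSq f A B) (hz : 0 < z.im) :
    (cauchyTransform f z).re =
      (1 / Real.pi) * ∫ y : ℝ, f y * (z.re - y) / ((z.re - y) ^ 2 + z.im ^ 2) := by
  have h : cauchyTransform f z = ((1 / Real.pi : ℝ) : ℂ) * ∫ y : ℝ, (f y : ℂ) / (z - y) := by
    simp [cauchyTransform]
  rw [h, Complex.re_ofReal_mul]
  congr 1
  rw [← RCLike.re_eq_complex_re, ← integral_re (hf.integrable_div_sub hz)]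
  congr 1; ext y; exact div_sub_re f z y

theorem cauchyTransform_im (hf : HolderSq f A B) (hz : 0 < z.im) :
    (cauchyTransform f z).im =
      -((1 / Real.pi) * ∫ y : ℝ, f y * z.im / ((z.re - y) ^ 2 + z.im ^ 2)) := by
  have h : cauchyTransform f z = ((1 / Real.pi : ℝ) : ℂ) * ∫ y : ℝ, (f y : ℂ) / (z - y) := by
    simp [cauchyTransform]
  rw [h, Complex.im_ofReal_mul, ← mul_neg, ← integral_neg]
  congr 1
  rw [← RCLike.im_eq_complex_im, ← integral_im (hf.integrable_div_sub hz)]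
  congr 1; ext y; exact div_sub_im f z y

theorem integral_eq_integral_Ioi_add {h : ℝ → ℝ} (hh : Integrable h) :
    ∫ t, h t = ∫ t in Ioi 0, (h t + h (-t)) := by
  have hn : IntegrableOn (fun t => h (-t)) (Ioi 0) := hh.comp_neg.integrableOn
  rw [integral_add hh.integrableOn hn, integral_comp_neg_Ioi, neg_zero, add_comm,
    intervalIntegral.integral_Iic_add_Ioi hh.integrableOn hh.integrableOn]

/-- Compared with `H f`, the integrand gains only the factor `t² / (t² + η²) ≤ 1`, which tends to
`1` as `η → 0`: dominated convergence applies at once. At `x = 0` this form also drives the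
tightness estimate. -/
theorem cauchyTransform_re_eq_symmQuot (hf : HolderSq f A B) (hz : 0 < z.im) :
    (cauchyTransform f z).re = (1 / Real.pi) *
      ∫ t in Ioi 0, symmQuot f z.re t * (t ^ 2 / (t ^ 2 + z.im ^ 2)) := by
  rw [hf.cauchyTransform_re hz, ← integral_sub_left_eq_self _ volume z.re,
    integral_eq_integral_Ioi_add ((hf.integrable_re hz).comp_sub_left z.re)]
  congr 1
  refine setIntegral_congr_fun measurableSet_Ioi fun t ht => ?_
  have ht' : t ≠ 0 := ne_of_gt ht
  rw [symmQuot, sub_sub_cancel, sub_sub_cancel, sub_neg_eq_add]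
  have : t ^ 2 + z.im ^ 2 ≠ 0 := by positivity
  field_simp
  ring

theorem tendsto_cauchyTransform_re (hf : HolderSq f A B) (x : ℝ) :
    Tendsto (fun η : ℝ => (cauchyTransform f (⟨x, η⟩ : ℂ)).re) (𝓝[>] 0)
      (𝓝 (hilbertTransform f x)) := by
  rw [hf.hilbertTransform_eq]
  have : Tendsto (fun η : ℝ => (1 / Real.pi) *
      ∫ t in Ioi 0, symmQuot f x t * (t ^ 2 / (t ^ 2 + η ^ 2))) (𝓝[>] 0)
      (𝓝 ((1 / Real.pi) * ∫ t in Ioi 0, symmQuot f x t)) := by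
    refine Tendsto.const_mul _ (tendsto_integral_filter_of_dominated_convergence
      (fun t => |symmQuot f x t|) ?_ ?_ (hf.integrableOn_symmQuot x).abs ?_)
    · refine Eventually.of_forall fun η => ?_
      refine (hf.integrableOn_symmQuot x).aestronglyMeasurable.mul ?_
      exact (by fun_prop : Measurable fun t : ℝ => t ^ 2 / (t ^ 2 + η ^ 2)).aestronglyMeasurable
    · refine Eventually.of_forall fun η => Eventually.of_forall fun t => ?_
      rw [norm_mul, Real.norm_eq_abs, Real.norm_eq_abs]
      refine mul_le_of_le_one_right (abs_nonneg _) ?_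
      rw [abs_of_nonneg (by positivity)]
      exact div_le_one_of_le₀ (by nlinarith [sq_nonneg η]) (by positivity)
    · filter_upwards [ae_restrict_mem measurableSet_Ioi] with t ht
      have ht' : (t:ℝ) ^ 2 ≠ 0 := pow_ne_zero 2 (ne_of_gt ht)
      have hc : ContinuousAt (fun η : ℝ => symmQuot f x t * (t ^ 2 / (t ^ 2 + η ^ 2))) 0 := by
        refine ContinuousAt.mul continuousAt_const (ContinuousAt.div₀ ?_ ?_ ?_)
        · fun_prop
        · fun_prop
        · simpa using ht'
      have h := hc.tendsto.mono_left (nhdsWithin_le_nhds (s := Ioi 0))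
      simpa [ht'] using h
  refine this.congr' ?_
  filter_upwards [self_mem_nhdsWithin] with η hη
  exact (hf.cauchyTransform_re_eq_symmQuot (z := ⟨x, η⟩) hη).symm

/-- The imaginary part is minus the Poisson integral; `y = x - η s` fixes the kernel and moves `η`
into the argument of `f`. -/
theorem tendsto_cauchyTransform_im (hf : HolderSq f A B) (x : ℝ) :
    Tendsto (fun η : ℝ => (cauchyTransform f (⟨x, η⟩ : ℂ)).im) (𝓝[>] 0) (𝓝 (-f x)) := by
  have h1 : Tendsto (fun η : ℝ => -((1 / Real.pi) * ∫ s : ℝ, f (x - η * s) * (1 + s ^ 2)⁻¹))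
      (𝓝[>] 0) (𝓝 (-((1 / Real.pi) * ∫ s : ℝ, f x * (1 + s ^ 2)⁻¹))) := by
    refine (Tendsto.const_mul _ (tendsto_integral_filter_of_dominated_convergence
      (fun s => √(2 * B + 2 * A ^ 2) * (1 + s ^ 2)⁻¹) ?_ ?_
      (integrable_inv_one_add_sq.const_mul _) ?_)).neg
    · refine Eventually.of_forall fun η => ?_
      have := hf.continuous
      have : Continuous fun s : ℝ => f (x - η * s) * (1 + s ^ 2)⁻¹ :=
        Continuous.mul (by fun_prop) (Continuous.inv₀ (by fun_prop) fun s => by positivity)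
      exact this.aestronglyMeasurable
    · refine Eventually.of_forall fun η => Eventually.of_forall fun s => ?_
      rw [norm_mul, Real.norm_eq_abs, Real.norm_eq_abs, abs_of_nonneg (by positivity :
        (0:ℝ) ≤ (1 + s ^ 2)⁻¹)]
      gcongr
      exact Real.abs_le_sqrt (hf.sq_le_of_holder _)
    · refine Eventually.of_forall fun s => ?_
      have hc : Continuous fun η : ℝ => f (x - η * s) * (1 + s ^ 2)⁻¹ := by
        have := hf.continuous
        fun_prop
      have h := (hc.tendsto 0).mono_left (nhdsWithin_le_nhds (s := Ioi 0))
      simpa using h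
  rw [integral_const_mul, integral_univ_inv_one_add_sq] at h1
  have hpi := Real.pi_ne_zero
  rw [show -((1 / Real.pi) * (f x * Real.pi)) = -f x by field_simp] at h1
  refine h1.congr' ?_
  filter_upwards [self_mem_nhdsWithin] with η hη
  have hη' : (0:ℝ) < η := hη
  rw [hf.cauchyTransform_im (z := ⟨x, η⟩) hη]
  congr 2
  dsimp only
  rw [← integral_sub_left_eq_self (fun y => f y * η / ((x - y) ^ 2 + η ^ 2)) volume x]
  have h := Measure.integral_comp_mul_left
    (fun t => f (x - t) * η / ((x - (x - t)) ^ 2 + η ^ 2)) η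
  rw [abs_of_pos (by positivity), smul_eq_mul] at h
  rw [← mul_inv_cancel_left₀ hη'.ne'
    (∫ t, f (x - t) * η / ((x - (x - t)) ^ 2 + η ^ 2)), ← h, ← integral_const_mul]
  congr 1; ext s
  rw [sub_sub_cancel]
  have : 1 + s ^ 2 ≠ 0 := by positivity
  have : (η * s) ^ 2 + η ^ 2 ≠ 0 := by positivity
  field_simp
  ring

/-- The Plemelj formula. -/
theorem tendsto_cauchyTransform (hf : HolderSq f A B) (x : ℝ) :
    Tendsto (fun η : ℝ => cauchyTransform f (⟨x, η⟩ : ℂ)) (𝓝[>] 0)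
      (𝓝 (⟨hilbertTransform f x, -f x⟩ : ℂ)) := by
  have h := (Complex.continuous_ofReal.tendsto _).comp (hf.tendsto_cauchyTransform_re x)
  have h' := ((Complex.continuous_ofReal.tendsto _).comp
    (hf.tendsto_cauchyTransform_im x)).mul_const Complex.I
  have h2 := h.add h'
  have e : ∀ z : ℂ, ((z.re : ℝ) : ℂ) + (z.im : ℝ) * Complex.I = z := Complex.re_add_im
  rw [show (⟨hilbertTransform f x, -f x⟩ : ℂ) = ((hilbertTransform f x : ℝ) : ℂ) +
    ((-f x : ℝ) : ℂ) * Complex.I by apply Complex.ext <;> simp]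
  exact h2.congr fun η => e _

end HolderSq

/-! ### The Riccati equation for the Cauchy transform. -/

/-- A family `W τ`, `0 ≤ τ ≤ T`, uniformly Hölder and square integrable, solving
`W_τ = (c + H(W)) W` pointwise. -/
structure HilbertFlow (W : ℝ → ℝ → ℝ) (c : ℝ → ℝ) (A B T : ℝ) : Prop where
  continuous_c : Continuous c
  holderSq : ∀ s ∈ Icc 0 T, HolderSq (W s) A B
  continuousOn : ContinuousOn (fun p : ℝ × ℝ => W p.1 p.2) (Ici 0 ×ˢ univ)
  hasDerivAt : ∀ s ∈ Ioo 0 T, ∀ x,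
    HasDerivAt (fun s => W s x) ((c s + hilbertTransform (W s) x) * W s x) s

namespace HilbertFlow

variable {W : ℝ → ℝ → ℝ} {c : ℝ → ℝ} {A B T : ℝ} {z : ℂ}

/-- The right-hand side of the equation divided by the Cauchy kernel. -/
noncomputable def source (W : ℝ → ℝ → ℝ) (c : ℝ → ℝ) (z : ℂ) (p : ℝ × ℝ) : ℂ :=
  (((c p.1 + hilbertTransform (W p.1) p.2) * W p.1 p.2 : ℝ) : ℂ) / (z - p.2)

theorem ae_mem_Ioo (T : ℝ) : ∀ᵐ s ∂(volume.restrict (Ioc 0 T)), s ∈ Ioo 0 T := by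
  rw [← restrict_Ioo_eq_restrict_Ioc]
  exact ae_restrict_mem measurableSet_Ioo

theorem continuous_extend (h : HilbertFlow W c A B T) :
    Continuous (Function.uncurry fun x s : ℝ => W (max s 0) x) := by
  have : Continuous fun p : ℝ × ℝ => (max p.2 0, p.1) := by fun_prop
  exact h.continuousOn.comp_continuous this fun p => ⟨mem_Ici.2 (le_max_right _ _), mem_univ _⟩

theorem deriv_extend (h : HilbertFlow W c A B T) {s : ℝ} (hs : s ∈ Ioo 0 T) (x : ℝ) :
    deriv (fun s => W (max s 0) x) s = (c s + hilbertTransform (W s) x) * W s x := by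
  refine ((h.hasDerivAt s hs x).congr_of_eventuallyEq ?_).deriv
  filter_upwards [lt_mem_nhds hs.1] with r hr
  rw [max_eq_left hr.le]

/-- Joint measurability of `H (W s) x` is obtained through the equation: the source is a time
derivative of the jointly continuous `W`, divided by the kernel. Clamping time at `0` makes `W`
continuous on the whole plane. -/
theorem aestronglyMeasurable_source (h : HilbertFlow W c A B T) (z : ℂ) :
    AEStronglyMeasurable (source W c z) ((volume.restrict (Ioc 0 T)).prod volume) := by
  have h1 : Measurable fun p : ℝ × ℝ => deriv (fun s => W (max s 0) p.1) p.2 :=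
    measurable_deriv_with_param h.continuous_extend
  have h2 : Measurable fun p : ℝ × ℝ =>
      ((deriv (fun s => W (max s 0) p.2) p.1 : ℝ) : ℂ) / (z - p.2) := by
    have h3 : Measurable fun p : ℝ × ℝ => deriv (fun s => W (max s 0) p.2) p.1 :=
      h1.comp measurable_swap
    fun_prop
  refine h2.aestronglyMeasurable.congr ?_
  have h4 : ∀ᵐ p : ℝ × ℝ ∂((volume.restrict (Ioc 0 T)).prod volume), p.1 ∈ Ioo 0 T :=
    Measure.quasiMeasurePreserving_fst.ae (ae_mem_Ioo T)
  filter_upwards [h4] with p hp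
  rw [source, h.deriv_extend hp]

theorem exists_norm_source_le (h : HilbertFlow W c A B T) :
    ∃ K, 0 ≤ K ∧ ∀ s ∈ Icc 0 T, ∀ (z : ℂ) (y : ℝ),
      ‖source W c z (s, y)‖ ≤ K * ‖(W s y : ℂ) / (z - y)‖ := by
  obtain ⟨K, hK⟩ := isCompact_Icc.exists_bound_of_continuousOn
    (s := Icc 0 T) h.continuous_c.continuousOn
  refine ⟨|K| + |(1 / Real.pi) * ((∫ t in Ioi 0, quotBound A t) + B)|, by positivity,
    fun s hs z y => ?_⟩
  rw [source, norm_div, norm_div, Complex.norm_real, Complex.norm_real, norm_mul, mul_div_assoc]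
  gcongr
  refine (norm_add_le _ _).trans (add_le_add ((hK s hs).trans (le_abs_self _)) ?_)
  exact ((h.holderSq s hs).abs_hilbertTransform_le y).trans (le_abs_self _)

theorem integrable_source_slice (h : HilbertFlow W c A B T) (hz : 0 < z.im) {s : ℝ}
    (hs : s ∈ Icc 0 T) : Integrable fun y => source W c z (s, y) := by
  obtain ⟨K, -, hK⟩ := h.exists_norm_source_le
  refine (((h.holderSq s hs).integrable_div_sub hz).norm.const_mul K).mono' ?_
    (Eventually.of_forall (hK s hs z))
  have h1 := (h.holderSq s hs).continuous
  have h2 := (h.holderSq s hs).continuous_hilbertTransform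
  have : Continuous fun y => source W c z (s, y) :=
    Continuous.div (by dsimp only; fun_prop) (by fun_prop) (sub_ofReal_ne_zero hz)
  exact this.aestronglyMeasurable

theorem integrable_source (h : HilbertFlow W c A B T) (hz : 0 < z.im) :
    Integrable (source W c z) ((volume.restrict (Ioc 0 T)).prod volume) := by
  have hm := h.aestronglyMeasurable_source z
  rw [integrable_prod_iff hm]
  refine ⟨?_, ?_⟩
  · filter_upwards [ae_mem_Ioo T] with s hs
    exact h.integrable_source_slice hz (Ioo_subset_Icc_self hs)
  · obtain ⟨K, hK0, hK⟩ := h.exists_norm_source_le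
    refine Integrable.mono' (g := fun _ => K * ((B + ∫ y : ℝ, ‖(z - y)⁻¹‖ ^ 2) / 2))
      (integrable_const _) hm.norm.integral_prod_right' ?_
    filter_upwards [ae_mem_Ioo T] with s hs
    have hs' := Ioo_subset_Icc_self hs
    rw [Real.norm_eq_abs, abs_of_nonneg (integral_nonneg fun y => norm_nonneg _)]
    have hf := h.holderSq s hs'
    have hk := integrable_norm_inv_sub_ofReal_sq hz
    calc ∫ y, ‖source W c z (s, y)‖ ≤ ∫ y, K * ((W s y ^ 2 + ‖(z - y)⁻¹‖ ^ 2) / 2) := by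
          refine integral_mono (h.integrable_source_slice hz hs').norm
            (((hf.integrable_sq.add hk).div_const 2).const_mul K) fun y => ?_
          refine (hK s hs' z y).trans ?_
          gcongr
          exact HolderSq.norm_div_sub_le _ z y
      _ = K * (((∫ y, W s y ^ 2) + ∫ y : ℝ, ‖(z - y)⁻¹‖ ^ 2) / 2) := by
          rw [integral_const_mul, integral_div, integral_add hf.integrable_sq hk]
      _ ≤ _ := by
          gcongr
          exact hf.sq_le

theorem integral_source_slice (h : HilbertFlow W c A B T) (hz : 0 < z.im) {s : ℝ}
    (hs : s ∈ Icc 0 T) : (1 / Real.pi : ℂ) * ∫ y, source W c z (s, y) =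
      c s * cauchyTransform (W s) z + cauchyTransform (W s) z ^ 2 / 2 := by
  have hf := h.holderSq s hs
  rw [← hf.cauchyTransform_hilbert_mul hz]
  have h1 := hf.integrable_div_sub hz
  have h2 : Integrable fun y : ℝ => ((hilbertTransform (W s) y * W s y : ℝ) : ℂ) / (z - y) := by
    refine ((h.integrable_source_slice hz hs).sub (h1.const_mul (c s : ℂ))).congr
      (Eventually.of_forall fun y => ?_)
    simp only [source, Pi.sub_apply]
    push_cast; ring
  have h3 : ∫ y, source W c z (s, y) = (c s * ∫ y : ℝ, (W s y : ℂ) / (z - y)) +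
      ∫ y : ℝ, ((hilbertTransform (W s) y * W s y : ℝ) : ℂ) / (z - y) := by
    rw [← integral_const_mul, ← integral_add (h1.const_mul _) h2]
    congr 1; ext y
    simp only [source]
    push_cast; ring
  rw [h3]
  unfold cauchyTransform
  ring

theorem sub_eq_integral (h : HilbertFlow W c A B T) {t : ℝ} (ht : t ∈ Icc 0 T) (y : ℝ) :
    W t y - W 0 y = ∫ s in Ioc 0 t, (c s + hilbertTransform (W s) y) * W s y := by
  have hcont : ContinuousOn (fun s => W s y) (Icc 0 t) := by
    have : Continuous fun s : ℝ => (s, y) := by fun_prop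
    exact h.continuousOn.comp this.continuousOn fun s hs => ⟨hs.1, mem_univ _⟩
  rw [← intervalIntegral.integral_of_le ht.1]
  refine (intervalIntegral.integral_eq_sub_of_hasDerivAt_of_le ht.1 hcont
    (fun s hs => h.hasDerivAt s ⟨hs.1, hs.2.trans_le ht.2⟩ y) ?_).symm
  rw [intervalIntegrable_iff_integrableOn_Ioc_of_le ht.1]
  obtain ⟨K, hK0, hK⟩ := h.exists_norm_source_le
  refine Integrable.mono' (g := fun _ => K * √(2 * B + 2 * A ^ 2))
    continuous_const.integrableOn_Ioc ?_ ?_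
  · refine (measurable_deriv fun s => W (max s 0) y).aestronglyMeasurable.congr ?_
    filter_upwards [ae_mem_Ioo t] with s hs
    exact h.deriv_extend ⟨hs.1, hs.2.trans_le ht.2⟩ y
  · filter_upwards [ae_mem_Ioo t] with s hs
    have hs' : s ∈ Icc 0 T := ⟨hs.1.le, hs.2.le.trans ht.2⟩
    have h1 := hK s hs' (y + 1) y
    simp only [source, add_sub_cancel_left, div_one, Complex.norm_real] at h1
    refine h1.trans ?_
    gcongr
    exact Real.abs_le_sqrt ((h.holderSq s hs').sq_le_of_holder y)

/-- Integrate the equation in time at each `y`, then against the Cauchy kernel; Fubini exchanges the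
integrals and Tricomi evaluates the inner one. -/
theorem cauchyTransform_eq_add_integral (h : HilbertFlow W c A B T) (hz : 0 < z.im)
    {t : ℝ} (ht : t ∈ Icc 0 T) : cauchyTransform (W t) z = cauchyTransform (W 0) z +
      ∫ s in (0:ℝ)..t, (c s * cauchyTransform (W s) z + cauchyTransform (W s) z ^ 2 / 2) := by
  have hT : (0:ℝ) ≤ T := ht.1.trans ht.2
  have ht' : HilbertFlow W c A B t :=
    ⟨h.continuous_c, fun s hs => h.holderSq s ⟨hs.1, hs.2.trans ht.2⟩, h.continuousOn,
      fun s hs => h.hasDerivAt s ⟨hs.1, hs.2.trans_le ht.2⟩⟩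
  have hI := ht'.integrable_source hz
  rw [← sub_eq_iff_eq_add', intervalIntegral.integral_of_le ht.1]
  have h1 : ∫ s in Ioc 0 t, (c s * cauchyTransform (W s) z + cauchyTransform (W s) z ^ 2 / 2) =
      ∫ s in Ioc 0 t, (1 / Real.pi : ℂ) * ∫ y, source W c z (s, y) :=
    setIntegral_congr_fun measurableSet_Ioc fun s hs =>
      (ht'.integral_source_slice hz (Ioc_subset_Icc_self hs)).symm
  rw [h1, integral_const_mul, integral_integral_swap (f := fun s y => source W c z (s, y)) hI]
  unfold cauchyTransform
  rw [← mul_sub, ← integral_sub ((h.holderSq t ht).integrable_div_sub hz)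
    ((h.holderSq 0 ⟨le_rfl, hT⟩).integrable_div_sub hz)]
  congr 1
  refine integral_congr_ae (Eventually.of_forall fun y => ?_)
  simp only [source]
  rw [integral_div, integral_complex_ofReal, ← h.sub_eq_integral ht]
  push_cast; ring

theorem integrableOn_rhs (h : HilbertFlow W c A B T) (hz : 0 < z.im) :
    IntegrableOn (fun s => c s * cauchyTransform (W s) z + cauchyTransform (W s) z ^ 2 / 2)
      (Ioc 0 T) := by
  refine ((h.integrable_source hz).integral_prod_left.const_mul (1 / Real.pi : ℂ)).congr ?_
  filter_upwards [ae_mem_Ioo T] with s hs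
  exact h.integral_source_slice hz (Ioo_subset_Icc_self hs)

/-- A bootstrap: the right-hand side is so far only integrable, but its primitive is continuous. The
right-hand side is then continuous as well, and the integral equation can be differentiated. -/
theorem continuousOn_cauchyTransform (h : HilbertFlow W c A B T) (hz : 0 < z.im) :
    ContinuousOn (fun s => cauchyTransform (W s) z) (Icc 0 T) := by
  have hI := h.integrableOn_rhs hz
  rw [← integrableOn_Icc_iff_integrableOn_Ioc] at hI
  rcases lt_or_ge T 0 with hT | hT
  · simp [Icc_eq_empty (not_le.2 hT)]
  rw [← uIcc_of_le hT] at hI ⊢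
  refine ContinuousOn.congr ((continuousOn_const (c := cauchyTransform (W 0) z)).add
    (intervalIntegral.continuousOn_primitive_interval hI)) fun t ht => ?_
  rw [uIcc_of_le hT] at ht
  exact h.cauchyTransform_eq_add_integral hz ht

theorem hasDerivWithinAt_cauchyTransform (h : HilbertFlow W c A B T) (hz : 0 < z.im)
    {t : ℝ} (ht : t ∈ Ico 0 T) : HasDerivWithinAt (fun s => cauchyTransform (W s) z)
      (c t * cauchyTransform (W t) z + cauchyTransform (W t) z ^ 2 / 2) (Ici t) t := by
  have hG := h.continuousOn_cauchyTransform hz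
  have hT : (0:ℝ) < T := ht.1.trans_lt ht.2
  set r := fun s => c s * cauchyTransform (W s) z + cauchyTransform (W s) z ^ 2 / 2 with hr
  have hrc : ContinuousOn r (Icc 0 T) := by
    have := h.continuous_c
    exact ((Complex.continuous_ofReal.comp this).continuousOn.mul hG).add
      ((hG.pow 2).div_const 2)
  have hmem : Ico t T ∈ 𝓝[≥] t := Ico_mem_nhdsGE ht.2
  have hcw : ContinuousWithinAt r (Ici t) t :=
    (hrc t (Ico_subset_Icc_self ht)).mono_of_mem_nhdsWithin
      (mem_of_superset hmem fun s hs => ⟨ht.1.trans hs.1, hs.2.le⟩)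
  have hd : HasDerivWithinAt (fun u => ∫ s in (0:ℝ)..u, r s) (r t) (Ici t) t := by
    refine intervalIntegral.integral_hasDerivWithinAt_right (t := Ioi t) ?_ ?_
      (hcw.mono Ioi_subset_Ici_self)
    · exact (hrc.mono (Icc_subset_Icc_right ht.2.le)).intervalIntegrable_of_Icc ht.1
    · refine ⟨Ioc t T, ?_, ?_⟩
      · exact Ioc_mem_nhdsGT ht.2
      · exact (hrc.mono fun s hs => ⟨ht.1.trans hs.1.le, hs.2⟩).aestronglyMeasurable
          measurableSet_Ioc
  refine (hd.const_add (cauchyTransform (W 0) z)).congr_of_eventuallyEq ?_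
    (h.cauchyTransform_eq_add_integral hz (Ico_subset_Icc_self ht))
  filter_upwards [hmem] with s hs
  exact h.cauchyTransform_eq_add_integral hz ⟨ht.1.trans hs.1, hs.2.le⟩

/-- Explicit solution of the Riccati equation for the Cauchy transform. -/
theorem cauchyTransform_mul_eq (h : HilbertFlow W c A B T) (hz : 0 < z.im) {E S : ℝ → ℝ}
    (hE : ∀ t, HasDerivAt E (c t * E t) t) (hS : ∀ t, HasDerivAt S (E t) t)
    (hE0 : E 0 = 1) (hS0 : S 0 = 0) {t : ℝ} (ht : t ∈ Icc 0 T) :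
    cauchyTransform (W t) z * (1 - S t * cauchyTransform (W 0) z / 2) =
      E t * cauchyTransform (W 0) z := by
  set G := fun s => cauchyTransform (W s) z with hGdef
  have hG := h.continuousOn_cauchyTransform hz
  -- `P` is the defect of the claimed identity. It solves the linear equation `P' = (c + G / 2) P`
  -- with `P 0 = 0`, so Grönwall gives `P = 0`. No division by `1 - S G₀ / 2`, which might vanish,
  -- is needed.
  set P := fun s => G s * (1 - S s * G 0 / 2) - E s * G 0 with hP
  have hEc : Continuous E := continuous_iff_continuousAt.2 fun t => (hE t).continuousAt
  have hSc : Continuous S := continuous_iff_continuousAt.2 fun t => (hS t).continuousAt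
  have hPc : ContinuousOn P (Icc 0 T) := by
    refine (hG.mul ?_).sub ?_ <;> exact Continuous.continuousOn (by fun_prop)
  have hPd : ∀ s ∈ Ico 0 T, HasDerivWithinAt P ((c s + G s / 2) * P s) (Ici s) s := by
    intro s hs
    have h1 := h.hasDerivWithinAt_cauchyTransform hz hs
    have h2 := ((hS s).ofReal_comp.hasDerivWithinAt (s := Ici s)).mul_const (G 0) |>.div_const 2
      |>.const_sub 1
    have h3 := ((hE s).ofReal_comp.hasDerivWithinAt (s := Ici s)).mul_const (G 0)
    refine ((h1.mul h2).sub h3).congr_deriv ?_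
    simp only [hP, hGdef]
    push_cast
    ring
  obtain ⟨K, hK⟩ := isCompact_Icc.exists_bound_of_continuousOn (s := Icc 0 T)
    (f := fun s => (c s : ℂ) + G s / 2)
    ((Complex.continuous_ofReal.comp h.continuous_c).continuousOn.add (hG.div_const 2))
  have hb := norm_le_gronwallBound_of_norm_deriv_right_le (δ := 0) (K := K) (ε := 0) hPc hPd
    (by simp [hP, hE0, hS0]) (fun s hs => by
      rw [norm_mul, add_zero]
      gcongr
      exact hK s (Ico_subset_Icc_self hs)) t ht
  rw [gronwallBound_ε0_δ0, norm_le_zero_iff] at hb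
  exact sub_eq_zero.1 hb

/-- Explicit solution on the real line. -/
theorem boundary_mul_eq (h : HilbertFlow W c A B T) {E S : ℝ → ℝ}
    (hE : ∀ t, HasDerivAt E (c t * E t) t) (hS : ∀ t, HasDerivAt S (E t) t)
    (hE0 : E 0 = 1) (hS0 : S 0 = 0) {t : ℝ} (ht : t ∈ Icc 0 T) (x : ℝ) :
    (⟨hilbertTransform (W t) x, -W t x⟩ : ℂ) *
        (1 - S t * (⟨hilbertTransform (W 0) x, -W 0 x⟩ : ℂ) / 2) =
      E t * (⟨hilbertTransform (W 0) x, -W 0 x⟩ : ℂ) := by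
  have h1 := (h.holderSq t ht).tendsto_cauchyTransform x
  have h0 := (h.holderSq 0 ⟨le_rfl, ht.1.trans ht.2⟩).tendsto_cauchyTransform x
  refine tendsto_nhds_unique ((h1.mul (tendsto_const_nhds.sub
    ((h0.const_mul (S t : ℂ)).div_const 2))).congr' ?_) (h0.const_mul (E t : ℂ))
  filter_upwards [self_mem_nhdsWithin] with η hη
  exact h.cauchyTransform_mul_eq (z := ⟨x, η⟩) hη hE hS hE0 hS0 ht

end HilbertFlow

/-! ### From `H¹` bounds to Hölder bounds. -/

theorem integral_sq_le_of_eLpNorm_le {f : ℝ → ℝ} (hf : MemLp f 2 volume) {M : NNReal}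
    (h : eLpNorm f 2 volume ≤ M) : ∫ x, f x ^ 2 ≤ (M : ℝ) ^ 2 := by
  rw [hf.eLpNorm_eq_integral_rpow_norm (by norm_num) (by norm_num)] at h
  have h0 : 0 ≤ ∫ x, f x ^ 2 := integral_nonneg fun x => sq_nonneg _
  have h1 : ∫ x, ‖f x‖ ^ (2 : ENNReal).toReal = ∫ x, f x ^ 2 := by
    congr 1; ext x; simp
  rw [h1, ENNReal.ofReal_le_iff_le_toReal (by simp), ENNReal.coe_toReal] at h
  have h2 : (2 : ENNReal).toReal⁻¹ = 1 / 2 := by norm_num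
  rw [h2, ← Real.sqrt_eq_rpow] at h
  exact (Real.sqrt_le_left M.2).1 h

/-- Young's inequality `2 |f'| ≤ l f'² + l⁻¹` with `l = √|x - y|`, integrated over the interval,
gives at most `l (D + 1)`. -/
theorem abs_sub_le_of_integral_deriv_sq {f : ℝ → ℝ} (hf : ContDiff ℝ 1 f)
    (hf' : MemLp (deriv f) 2 volume) {D : ℝ} (hD : ∫ x, deriv f x ^ 2 ≤ D) (x y : ℝ) :
    |f x - f y| ≤ (D + 1) / 2 * √|x - y| := by
  have hsq := hf'.integrable_sq
  wlog hxy : y ≤ x generalizing x y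
  · rw [abs_sub_comm, abs_sub_comm x y]; exact this y x (le_of_not_ge hxy)
  rcases eq_or_lt_of_le hxy with rfl | hlt
  · simp
  set l := √|x - y| with hl
  have hl0 : 0 < l := Real.sqrt_pos.2 (abs_pos.2 (by linarith))
  have hl2 : l ^ 2 = x - y := by rw [hl, Real.sq_sqrt (abs_nonneg _), abs_of_pos (by linarith)]
  have hc : Continuous (deriv f) := hf.continuous_deriv le_rfl
  have h1 : ∫ t in y..x, deriv f t = f x - f y :=
    intervalIntegral.integral_deriv_eq_sub (fun t _ => (hf.differentiable one_ne_zero) t)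
      (hc.intervalIntegrable _ _)
  rw [← h1]
  calc |∫ t in y..x, deriv f t| ≤ ∫ t in y..x, |deriv f t| :=
        intervalIntegral.abs_integral_le_integral_abs hxy
    _ ≤ ∫ t in y..x, (l * deriv f t ^ 2 + l⁻¹) / 2 := by
        refine intervalIntegral.integral_mono_on hxy (hc.abs.intervalIntegrable _ _)
          (Continuous.intervalIntegrable (by fun_prop) _ _) fun t _ => ?_
        have h := sq_nonneg (l * |deriv f t| - 1)
        have h2 : |deriv f t| ^ 2 = deriv f t ^ 2 := sq_abs _
        have h3 : l * ((l * deriv f t ^ 2 + l⁻¹) / 2) = (l ^ 2 * deriv f t ^ 2 + 1) / 2 := by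
          field_simp
        have h4 : l * |deriv f t| ≤ l * ((l * deriv f t ^ 2 + l⁻¹) / 2) := by
          rw [h3, ← h2]; nlinarith
        exact le_of_mul_le_mul_left h4 hl0
    _ = (l * (∫ t in y..x, deriv f t ^ 2) + l⁻¹ * (x - y)) / 2 := by
        rw [intervalIntegral.integral_div, intervalIntegral.integral_add
          (Continuous.intervalIntegrable (by fun_prop) _ _) (by simp),
          intervalIntegral.integral_const_mul, intervalIntegral.integral_const, smul_eq_mul,
          mul_comm (x - y)]
    _ ≤ (l * D + l⁻¹ * (x - y)) / 2 := by
        gcongr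
        refine le_trans ?_ hD
        rw [intervalIntegral.integral_of_le hxy]
        exact setIntegral_le_integral hsq (Eventually.of_forall fun t => sq_nonneg _)
    _ = (D + 1) / 2 * l := by rw [← hl2]; field_simp

/-! ### Lagrangian coordinates and the explicit solution. -/

/-- Primitive of a rate given on `[0,∞)`. -/
noncomputable def ratePrimitive (c : ℝ → ℝ) (t : ℝ) : ℝ := ∫ s in (0:ℝ)..t, c (max s 0)

theorem continuous_rate {c : ℝ → ℝ} (hc : ContinuousOn c (Ici 0)) :
    Continuous fun s => c (max s 0) :=
  hc.comp_continuous (by fun_prop) fun s => mem_Ici.2 (le_max_right s 0)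

theorem hasDerivAt_ratePrimitive {c : ℝ → ℝ} (hc : ContinuousOn c (Ici 0)) (t : ℝ) :
    HasDerivAt (ratePrimitive c) (c (max t 0)) t :=
  (continuous_rate hc).integral_hasStrictDerivAt 0 t |>.hasDerivAt

theorem hasDerivAt_exp_ratePrimitive {c : ℝ → ℝ} (hc : ContinuousOn c (Ici 0)) (t : ℝ) :
    HasDerivAt (fun t => Real.exp (ratePrimitive c t))
      (c (max t 0) * Real.exp (ratePrimitive c t)) t := by
  simpa [mul_comm] using (hasDerivAt_ratePrimitive hc t).exp

theorem continuous_exp_ratePrimitive {c : ℝ → ℝ} (hc : ContinuousOn c (Ici 0)) :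
    Continuous fun t => Real.exp (ratePrimitive c t) :=
  continuous_iff_continuousAt.2 fun t => (hasDerivAt_exp_ratePrimitive hc t).continuousAt

theorem ratePrimitive_zero (c : ℝ → ℝ) : ratePrimitive c 0 = 0 := by simp [ratePrimitive]

namespace IsDynamicRescalingSolution

variable {cl cω : ℝ → ℝ} {Ω : ℝ → ℝ → ℝ}

theorem contDiff_slice (h : IsDynamicRescalingSolution cl cω Ω) {τ : ℝ} (hτ : 0 ≤ τ) :
    ContDiff ℝ 1 (Ω τ) := by
  have h1 : ContDiff ℝ 1 fun x : ℝ => (τ, x) := by fun_prop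
  exact h.contDiffOn.comp_contDiff h1 fun x => ⟨hτ, mem_univ _⟩

theorem exists_holderSq (h : IsDynamicRescalingSolution cl cω Ω) (T : ℝ) :
    ∃ A B, 0 ≤ A ∧ 0 ≤ B ∧ ∀ τ ∈ Icc 0 T, HolderSq (Ω τ) A B := by
  obtain ⟨M, hM⟩ := h.locally_bounded T
  refine ⟨((M:ℝ) ^ 2 + 1) / 2, (M:ℝ) ^ 2, by positivity, by positivity, fun τ hτ => ?_⟩
  have hc := h.contDiff_slice hτ.1
  obtain ⟨h1, h2⟩ := hM τ hτ.1 hτ.2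
  exact ⟨hc.continuous, (h.memLp τ hτ.1).integrable_sq,
    abs_sub_le_of_integral_deriv_sq hc (h.memLp_deriv τ hτ.1)
      (integral_sq_le_of_eLpNorm_le (h.memLp_deriv τ hτ.1) h2),
    integral_sq_le_of_eLpNorm_le (h.memLp τ hτ.1) h1⟩

/-- The solution in Lagrangian coordinates for the field `c_l X`. -/
noncomputable def dilated (cl : ℝ → ℝ) (Ω : ℝ → ℝ → ℝ) (τ x : ℝ) : ℝ :=
  Ω τ (Real.exp (ratePrimitive cl τ) * x)

theorem dilated_zero (cl : ℝ → ℝ) (Ω : ℝ → ℝ → ℝ) : dilated cl Ω 0 = Ω 0 := by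
  ext x; simp [dilated, ratePrimitive_zero]

/-- By the chain rule, motion along `X = L x` contributes `c_l X Ω_X`, cancelling the transport
term. -/
theorem hasDerivAt_dilated (h : IsDynamicRescalingSolution cl cω Ω) {s : ℝ} (hs : 0 < s) (x : ℝ) :
    HasDerivAt (fun s => dilated cl Ω s x)
      ((cω s + hilbertTransform (Ω s) (Real.exp (ratePrimitive cl s) * x)) *
        Ω s (Real.exp (ratePrimitive cl s) * x)) s := by
  set X := Real.exp (ratePrimitive cl s) * x with hX
  have hnhds : Ici (0:ℝ) ×ˢ (univ : Set ℝ) ∈ 𝓝 (s, X) :=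
    prod_mem_nhds (Ici_mem_nhds hs) univ_mem
  have hd : DifferentiableAt ℝ (fun p : ℝ × ℝ => Ω p.1 p.2) (s, X) :=
    (h.contDiffOn.differentiableOn one_ne_zero).differentiableAt hnhds
  obtain ⟨D, hD⟩ := hd
  have e1 : HasDerivAt (fun s => Ω s X) (D (1, 0)) s := by
    have := hD.comp_hasDerivAt s ((hasDerivAt_id s).prodMk (hasDerivAt_const s X))
    exact this
  have e2 : HasDerivAt (Ω s) (D (0, 1)) X := by
    have := hD.comp_hasDerivAt X ((hasDerivAt_const X s).prodMk (hasDerivAt_id X))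
    exact this
  have e3 := ((h.equation s hs.le X).hasDerivAt (Ici_mem_nhds hs)).unique e1
  rw [e2.deriv] at e3
  have e4 : HasDerivAt (fun s => Real.exp (ratePrimitive cl s) * x) (cl s * X) s := by
    have := (hasDerivAt_exp_ratePrimitive h.continuousOn_cl s).mul_const x
    rwa [max_eq_left hs.le, mul_assoc] at this
  have e5 : HasDerivAt (fun s => dilated cl Ω s x) (D (1, cl s * X)) s := by
    have := HasFDerivAt.comp_hasDerivAt (l := fun p : ℝ × ℝ => Ω p.1 p.2)
      (f := fun s => (s, Real.exp (ratePrimitive cl s) * x)) s hD ((hasDerivAt_id s).prodMk e4)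
    exact this
  refine e5.congr_deriv ?_
  rw [show ((1 : ℝ), cl s * X) = (1, 0) + (cl s * X) • ((0 : ℝ), (1 : ℝ)) by simp,
    map_add, map_smul, smul_eq_mul, ← e3]
  ring

theorem exists_hilbertFlow (h : IsDynamicRescalingSolution cl cω Ω) (T : ℝ) :
    ∃ A B, HilbertFlow (dilated cl Ω) (fun s => cω (max s 0)) A B T := by
  obtain ⟨A, B, hA, hB, hf⟩ := h.exists_holderSq T
  have hLc := continuous_exp_ratePrimitive h.continuousOn_cl
  obtain ⟨M, hM⟩ := isCompact_Icc.exists_bound_of_continuousOn (s := Icc 0 T) hLc.continuousOn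
  obtain ⟨m, hm⟩ := isCompact_Icc.exists_bound_of_continuousOn (s := Icc 0 T)
    (hLc.inv₀ fun t => (Real.exp_pos _).ne').continuousOn
  have hW : ∀ s ∈ Icc 0 T, HolderSq (dilated cl Ω s) (A * √M) (m * B) := by
    intro s hs
    refine ((hf s hs).comp_mul (Real.exp_pos (ratePrimitive cl s))).mono ?_ ?_
    · gcongr
      exact (le_abs_self _).trans (hM s hs)
    · gcongr
      exact (le_abs_self _).trans (hm s hs)
  refine ⟨A * √M, m * B, continuous_rate h.continuousOn_cω, hW, ?_, fun s hs x => ?_⟩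
  · refine h.contDiffOn.continuousOn.comp
      (f := fun p : ℝ × ℝ => (p.1, Real.exp (ratePrimitive cl p.1) * p.2)) ?_
      fun p hp => ⟨hp.1, mem_univ _⟩
    have : Continuous fun p : ℝ × ℝ => Real.exp (ratePrimitive cl p.1) :=
      hLc.comp continuous_fst
    exact Continuous.continuousOn (by fun_prop)
  · have hs' := Ioo_subset_Icc_self hs
    refine (h.hasDerivAt_dilated hs.1 x).congr_deriv ?_
    rw [max_eq_left hs.1.le]
    have := (hf s hs').hilbertTransform_comp_mul (Real.exp_pos (ratePrimitive cl s)) (hW s hs') x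
    rw [← this]
    rfl

/-- Time integral of the growth factor `exp ∫ c_ω`. -/
noncomputable def growthIntegral (cω : ℝ → ℝ) (t : ℝ) : ℝ :=
  ∫ s in (0:ℝ)..t, Real.exp (ratePrimitive cω s)

theorem hasDerivAt_growthIntegral (h : IsDynamicRescalingSolution cl cω Ω) (t : ℝ) :
    HasDerivAt (growthIntegral cω) (Real.exp (ratePrimitive cω t)) t :=
  (continuous_exp_ratePrimitive h.continuousOn_cω).integral_hasStrictDerivAt 0 t |>.hasDerivAt

theorem growthIntegral_zero (cω : ℝ → ℝ) : growthIntegral cω 0 = 0 := by simp [growthIntegral]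

/-- Explicit formula for `H(Ω) - iΩ` in terms of the initial data. -/
theorem explicit_formula (h : IsDynamicRescalingSolution cl cω Ω) {t : ℝ} (ht : 0 ≤ t) (x : ℝ) :
    (⟨hilbertTransform (Ω t) (Real.exp (ratePrimitive cl t) * x),
        -Ω t (Real.exp (ratePrimitive cl t) * x)⟩ : ℂ) *
        (1 - growthIntegral cω t * (⟨hilbertTransform (Ω 0) x, -Ω 0 x⟩ : ℂ) / 2) =
      Real.exp (ratePrimitive cω t) * (⟨hilbertTransform (Ω 0) x, -Ω 0 x⟩ : ℂ) := by
  obtain ⟨A, B, hF⟩ := h.exists_hilbertFlow t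
  obtain ⟨A', B', -, -, hf⟩ := h.exists_holderSq t
  have := hF.boundary_mul_eq (hasDerivAt_exp_ratePrimitive h.continuousOn_cω)
    h.hasDerivAt_growthIntegral (by simp [ratePrimitive_zero]) (growthIntegral_zero _)
    ⟨ht, le_rfl⟩ x
  rw [dilated_zero] at this
  rw [← (hf t ⟨ht, le_rfl⟩).hilbertTransform_comp_mul
    (Real.exp_pos (ratePrimitive cl t)) (hF.holderSq t ⟨ht, le_rfl⟩) x]
  exact this

/-- The version off the real axis is used on the imaginary axis to control mass at infinity. -/
theorem explicit_formula_upper (h : IsDynamicRescalingSolution cl cω Ω) {t : ℝ} (ht : 0 ≤ t)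
    {z : ℂ} (hz : 0 < z.im) :
    cauchyTransform (Ω t) (Real.exp (ratePrimitive cl t) * z) *
        (1 - growthIntegral cω t * cauchyTransform (Ω 0) z / 2) =
      Real.exp (ratePrimitive cω t) * cauchyTransform (Ω 0) z := by
  obtain ⟨A, B, hF⟩ := h.exists_hilbertFlow t
  have := hF.cauchyTransform_mul_eq hz (hasDerivAt_exp_ratePrimitive h.continuousOn_cω)
    h.hasDerivAt_growthIntegral (by simp [ratePrimitive_zero]) (growthIntegral_zero _)
    ⟨ht, le_rfl⟩
  rw [dilated_zero] at this
  rw [← this]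
  congr 1
  set L := Real.exp (ratePrimitive cl t) with hL
  have hL0 : 0 < L := Real.exp_pos _
  have hL0' : (L : ℂ) ≠ 0 := by exact_mod_cast hL0.ne'
  unfold cauchyTransform
  congr 1
  have e := Measure.integral_comp_mul_left (fun y : ℝ => (Ω t y : ℂ) / (L * z - y)) L
  rw [abs_of_pos (by positivity)] at e
  rw [← smul_inv_smul₀ hL0.ne' (∫ y : ℝ, (Ω t y : ℂ) / (L * z - y)), ← e, ← integral_smul]
  congr 1; ext y
  have h1 := sub_ofReal_ne_zero hz y
  have h2 : (L : ℂ) * z - L * y ≠ 0 := by rw [← mul_sub]; exact mul_ne_zero hL0' h1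
  simp only [dilated, Complex.real_smul]
  push_cast
  rw [← hL, ← mul_sub]
  field_simp

end IsDynamicRescalingSolution

/-! ### Second-order expansions at the origin. -/

theorem tendsto_sub_div_sq {g : ℝ → ℝ} (hg : Continuous g) {d : ℝ → ℝ} {a : ℝ}
    (hd : ∀ᶠ x in 𝓝[≠] (0:ℝ), HasDerivAt g (d x) x)
    (hlim : Tendsto (fun x => d x / x) (𝓝[≠] 0) (𝓝 a)) :
    Tendsto (fun x => (g x - g 0) / x ^ 2) (𝓝[≠] 0) (𝓝 (a / 2)) := by
  refine HasDerivAt.lhopital_zero_nhdsNE (f' := d) (g' := fun x => 2 * x) ?_ ?_ ?_ ?_ ?_ ?_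
  · filter_upwards [hd] with x hx using hx.sub_const _
  · exact Eventually.of_forall fun x => by simpa using hasDerivAt_pow 2 x
  · filter_upwards [self_mem_nhdsWithin] with x hx
    exact mul_ne_zero two_ne_zero hx
  · have : Continuous fun x => g x - g 0 := by fun_prop
    have h := (this.tendsto 0).mono_left (nhdsWithin_le_nhds (s := {0}ᶜ))
    simpa using h
  · have : Continuous fun x : ℝ => x ^ 2 := by fun_prop
    have h := (this.tendsto 0).mono_left (nhdsWithin_le_nhds (s := {0}ᶜ))
    simpa using h
  · refine (hlim.div_const 2).congr fun x => ?_
    rw [div_div, mul_comm x 2]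

theorem HasDerivAt.tendsto_div {d : ℝ → ℝ} {a : ℝ} (h : HasDerivAt d a 0) (h0 : d 0 = 0) :
    Tendsto (fun x => d x / x) (𝓝[≠] 0) (𝓝 a) := by
  refine h.tendsto_slope.congr fun x => ?_
  rw [slope_def_field, h0, sub_zero, sub_zero]

/-- No differentiability is assumed: a nonzero value of `deriv` certifies it, since the default is
`0`. Thus `a ≠ 0` makes `deriv g` differentiable at `0`, and `deriv g x / x → a` makes `g`
differentiable at nearby `x ≠ 0`. L'Hôpital's rule then applies. -/
theorem tendsto_sub_div_sq_of_even {g : ℝ → ℝ} (hg : Continuous g) (heven : ∀ x, g (-x) = g x)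
    {a : ℝ} (ha : a ≠ 0) (h2 : iteratedDeriv 2 g 0 = a) :
    Tendsto (fun x => (g x - g 0) / x ^ 2) (𝓝[≠] 0) (𝓝 (a / 2)) := by
  rw [iteratedDeriv_succ, iteratedDeriv_one] at h2
  have hd : HasDerivAt (deriv g) a 0 := by
    rw [← h2]
    exact (differentiableAt_of_deriv_ne_zero (by rw [h2]; exact ha)).hasDerivAt
  have h0 : deriv g 0 = 0 := by
    have h := deriv_comp_neg g 0
    rw [show (fun x => g (-x)) = g from funext heven, neg_zero] at h
    linarith
  have hlim := hd.tendsto_div h0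
  refine tendsto_sub_div_sq hg ?_ hlim
  filter_upwards [hlim.eventually_ne ha] with x hx
  refine (differentiableAt_of_deriv_ne_zero fun h => hx ?_).hasDerivAt
  rw [h, zero_div]

theorem tendsto_div_sq_of_odd {f : ℝ → ℝ} (hf : ContDiff ℝ ∞ f) (hodd : ∀ x, f (-x) = -f x)
    (h0 : deriv f 0 = 0) : Tendsto (fun x => f x / x ^ 2) (𝓝[≠] 0) (𝓝 0) := by
  have hf0 : f 0 = 0 := by have := hodd 0; rw [neg_zero] at this; linarith
  have e1 : ∀ x, deriv f (-x) = deriv f x := by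
    intro x
    have h := deriv_comp_neg f x
    rw [show (fun x => f (-x)) = fun x => -f x from funext hodd, deriv.fun_neg] at h
    linarith
  have hd : DifferentiableAt ℝ (deriv f) 0 := by
    have h2 : ContDiff ℝ (1 + 1) f := by
      have := contDiff_infty.1 hf 2
      norm_num at this ⊢
      exact this
    have h1 : ContDiff ℝ 1 (deriv f) := (contDiff_succ_iff_deriv.1 h2).2.2
    exact h1.differentiable one_ne_zero 0
  have e2 : deriv (deriv f) 0 = 0 := by
    have h := deriv_comp_neg (deriv f) 0
    rw [show (fun x => deriv f (-x)) = deriv f from funext e1, neg_zero] at h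
    linarith
  have hlim := (hd.hasDerivAt.tendsto_div h0)
  rw [e2] at hlim
  have h := tendsto_sub_div_sq hf.continuous
    (Eventually.of_forall fun x => ((hf.differentiable (by simp)) x).hasDerivAt) hlim
  simpa [hf0] using h

theorem HolderSq.hilbertTransform_neg {f : ℝ → ℝ} {A B : ℝ} (hf : HolderSq f A B)
    (hodd : ∀ x, f (-x) = -f x) (x : ℝ) : hilbertTransform f (-x) = hilbertTransform f x := by
  rw [hf.hilbertTransform_eq, hf.hilbertTransform_eq]
  congr 2; ext t
  rw [symmQuot, symmQuot, ← neg_add', hodd, show -x + t = -(x - t) by ring, hodd]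
  ring

/-! ### The first normalization determines `c_ω`. -/

namespace IsDynamicRescalingSolution

variable {cl cω : ℝ → ℝ} {Ω : ℝ → ℝ → ℝ}

theorem exists_holderSq_slice (h : IsDynamicRescalingSolution cl cω Ω) {t : ℝ} (ht : 0 ≤ t) :
    ∃ A B, HolderSq (Ω t) A B := by
  obtain ⟨A, B, -, -, hf⟩ := h.exists_holderSq t
  exact ⟨A, B, hf t ⟨ht, le_rfl⟩⟩

/-- At the origin the explicit formula reads `2 (1 - S) = 2 E`. -/
theorem exp_ratePrimitive_eq (h : IsDynamicRescalingSolution cl cω Ω) (h0 : Ω 0 0 = 0)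
    (hnorm : ∀ τ : ℝ, 0 ≤ τ → hilbertTransform (Ω τ) 0 = 2) {t : ℝ} (ht : 0 ≤ t) :
    Real.exp (ratePrimitive cω t) = 1 - growthIntegral cω t := by
  have e := h.explicit_formula ht 0
  rw [mul_zero, hnorm t ht, hnorm 0 le_rfl, h0] at e
  generalize Real.exp (ratePrimitive cω t) = r at e ⊢
  have := congrArg Complex.re e
  simp [Complex.mul_re] at this
  linarith

/-- Differentiate `E = 1 - S`: since `E' = c_ω E` and `S' = E`, `(c_ω + 1) E = 0`. Derivatives from
the right include `t = 0`. -/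
theorem cω_eq (h : IsDynamicRescalingSolution cl cω Ω) (h0 : Ω 0 0 = 0)
    (hnorm : ∀ τ : ℝ, 0 ≤ τ → hilbertTransform (Ω τ) 0 = 2) {t : ℝ} (ht : 0 ≤ t) :
    cω t = -1 := by
  have h1 := (hasDerivAt_exp_ratePrimitive h.continuousOn_cω t).hasDerivWithinAt (s := Ici t)
  have h2 := ((h.hasDerivAt_growthIntegral t).const_sub 1).hasDerivWithinAt (s := Ici t)
  have h3 := h2.congr (fun s hs => h.exp_ratePrimitive_eq h0 hnorm (ht.trans hs))
    (h.exp_ratePrimitive_eq h0 hnorm ht)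
  have h4 := (uniqueDiffOn_Ici t t self_mem_Ici).eq_deriv _ h1 h3
  rw [max_eq_left ht] at h4
  have h5 := Real.exp_pos (ratePrimitive cω t)
  have h6 : (cω t + 1) * Real.exp (ratePrimitive cω t) = 0 := by linarith
  rcases mul_eq_zero.1 h6 with h7 | h7 <;> linarith

theorem exp_ratePrimitive_cω (h : IsDynamicRescalingSolution cl cω Ω) (h0 : Ω 0 0 = 0)
    (hnorm : ∀ τ : ℝ, 0 ≤ τ → hilbertTransform (Ω τ) 0 = 2) (t : ℝ) :
    Real.exp (ratePrimitive cω t) = Real.exp (-t) := by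
  have : ratePrimitive cω t = ∫ s in (0:ℝ)..t, (-1 : ℝ) :=
    intervalIntegral.integral_congr fun s _ => h.cω_eq h0 hnorm (le_max_right s 0)
  rw [this]; simp

/-- Real and imaginary parts of the explicit formula, when `c_ω = -1`. -/
theorem explicit_formula_parts (h : IsDynamicRescalingSolution cl cω Ω) (h0 : Ω 0 0 = 0)
    (hnorm : ∀ τ : ℝ, 0 ≤ τ → hilbertTransform (Ω τ) 0 = 2) {t : ℝ} (ht : 0 ≤ t) (x : ℝ) :
    let E := Real.exp (-t)
    let α := hilbertTransform (Ω 0) x - 2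
    let D := (E - (1 - E) * α / 2) ^ 2 + ((1 - E) * Ω 0 x / 2) ^ 2
    0 < D ∧ Ω t (Real.exp (ratePrimitive cl t) * x) * D = E * Ω 0 x ∧
      (hilbertTransform (Ω t) (Real.exp (ratePrimitive cl t) * x) - 2) * D =
        (E - (1 - E) * α / 2) * α - (1 - E) * Ω 0 x ^ 2 / 2 := by
  intro E α D
  have e := h.explicit_formula ht x
  have hS : growthIntegral cω t = 1 - E := by
    have := h.exp_ratePrimitive_eq h0 hnorm ht
    rw [h.exp_ratePrimitive_cω h0 hnorm t] at this
    linarith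
  rw [h.exp_ratePrimitive_cω h0 hnorm t, hS, show hilbertTransform (Ω 0) x = α + 2 by
    simp only [α]; ring] at e
  set u := hilbertTransform (Ω t) (Real.exp (ratePrimitive cl t) * x)
  set v := Ω t (Real.exp (ratePrimitive cl t) * x)
  set b := Ω 0 x
  change (⟨u, -v⟩ : ℂ) * (1 - ((1 - E : ℝ) : ℂ) * ⟨α + 2, -b⟩ / 2) = (E : ℂ) * ⟨α + 2, -b⟩ at e
  have hE : 0 < E := Real.exp_pos _
  have e0 : (1 - ((1 - E : ℝ) : ℂ) * ⟨α + 2, -b⟩ / 2) =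
      ⟨E - (1 - E) * α / 2, (1 - E) * b / 2⟩ := by
    apply Complex.ext
    · simp
      ring
    · simp
      ring
  rw [e0] at e
  have hre := congrArg Complex.re e
  have him := congrArg Complex.im e
  simp only [Complex.mul_re, Complex.mul_im, Complex.ofReal_re, Complex.ofReal_im, zero_mul,
    sub_zero, add_zero] at hre him
  set p := E - (1 - E) * α / 2 with hp
  set q := (1 - E) * b / 2 with hq
  -- If `p = q = 0`, the left side of the formula vanishes, so `α = -2`; but then `p = E + (1 - E) =
  -- 1`.
  have hDpos : 0 < p ^ 2 + q ^ 2 := by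
    rcases eq_or_ne p 0 with h1 | h1
    · rcases eq_or_ne q 0 with h2 | h2
      · exfalso
        rw [h1, h2] at hre him
        have h3 : E * (α + 2) = 0 := by linarith
        have h5 : α + 2 = 0 := by
          rcases mul_eq_zero.1 h3 with h | h
          · exact absurd h hE.ne'
          · exact h
        have h6 : α = -2 := by linarith
        rw [hp, h6] at h1
        linarith
      · positivity
    · positivity
  refine ⟨hDpos, ?_, ?_⟩
  · change v * (p ^ 2 + q ^ 2) = E * b
    have : v * (p ^ 2 + q ^ 2) = q * (u * p - -v * q) - p * (u * q + -v * p) := by ring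
    rw [this, hre, him, hp, hq]; ring
  · change (u - 2) * (p ^ 2 + q ^ 2) = p * α - (1 - E) * b ^ 2 / 2
    have : (u - 2) * (p ^ 2 + q ^ 2) =
        p * (u * p - -v * q) + q * (u * q + -v * p) - 2 * (p ^ 2 + q ^ 2) := by ring
    rw [this, hre, him, hp, hq]; ring

end IsDynamicRescalingSolution

/-! ### Parity, sign, and the second normalization determining `c_l`. -/

/-- Odd, nonpositive on the right, degenerate data normalized at the origin, and a solution of the
dynamic rescaling equation obeying the normalization conditions. -/
structure NormalizedSolution (cl cω : ℝ → ℝ) (Ω : ℝ → ℝ → ℝ) : Prop where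
  solution : IsDynamicRescalingSolution cl cω Ω
  odd : ∀ x, Ω 0 (-x) = -Ω 0 x
  neg : ∀ x, 0 < x → Ω 0 x < 0
  tendsto_div_sq : Tendsto (fun x => Ω 0 x / x ^ 2) (𝓝[≠] 0) (𝓝 0)
  hilbert_zero : ∀ t, 0 ≤ t → hilbertTransform (Ω t) 0 = 2
  hilbert_deriv_two : ∀ t, 0 ≤ t → iteratedDeriv 2 (hilbertTransform (Ω t)) 0 = 4

namespace NormalizedSolution

variable {cl cω : ℝ → ℝ} {Ω : ℝ → ℝ → ℝ}

theorem zero_zero (h : NormalizedSolution cl cω Ω) : Ω 0 0 = 0 := by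
  have := h.odd 0
  rw [neg_zero] at this
  linarith

theorem hilbert_zero_neg (h : NormalizedSolution cl cω Ω) (x : ℝ) :
    hilbertTransform (Ω 0) (-x) = hilbertTransform (Ω 0) x := by
  obtain ⟨A, B, hf⟩ := h.solution.exists_holderSq_slice le_rfl
  exact hf.hilbertTransform_neg h.odd x

theorem odd_slice (h : NormalizedSolution cl cω Ω) {t : ℝ} (ht : 0 ≤ t) (X : ℝ) :
    Ω t (-X) = -Ω t X := by
  set L := Real.exp (ratePrimitive cl t) with hL
  have hL0 : 0 < L := Real.exp_pos _
  have hX : X = L * (X / L) := by field_simp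
  rw [hX, ← mul_neg]
  obtain ⟨hD, h1, -⟩ := h.solution.explicit_formula_parts h.zero_zero h.hilbert_zero ht (X / L)
  obtain ⟨-, h2, -⟩ := h.solution.explicit_formula_parts h.zero_zero h.hilbert_zero ht (-(X / L))
  rw [← hL] at h1 h2
  rw [h.odd, h.hilbert_zero_neg, mul_neg (1 - _), neg_div, neg_sq] at h2
  refine mul_right_cancel₀ hD.ne' ?_
  linarith

theorem nonpos_slice (h : NormalizedSolution cl cω Ω) {t : ℝ} (ht : 0 ≤ t) {X : ℝ} (hX : 0 < X) :
    Ω t X ≤ 0 := by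
  set L := Real.exp (ratePrimitive cl t) with hL
  have hL0 : 0 < L := Real.exp_pos _
  have hX' : X = L * (X / L) := by field_simp
  obtain ⟨hD, h1, -⟩ := h.solution.explicit_formula_parts h.zero_zero h.hilbert_zero ht (X / L)
  rw [← hL, ← hX'] at h1
  have h2 := h.neg (X / L) (by positivity)
  by_contra hcon
  push Not at hcon
  have h3 := mul_pos hcon hD
  rw [h1] at h3
  have h4 := mul_neg_of_pos_of_neg (Real.exp_pos (-t)) h2
  linarith

theorem hilbert_expansion (h : NormalizedSolution cl cω Ω) {t : ℝ} (ht : 0 ≤ t) :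
    Tendsto (fun x => (hilbertTransform (Ω t) x - 2) / x ^ 2) (𝓝[≠] 0) (𝓝 2) := by
  obtain ⟨A, B, hf⟩ := h.solution.exists_holderSq_slice ht
  have := tendsto_sub_div_sq_of_even hf.continuous_hilbertTransform
    (hf.hilbertTransform_neg (h.odd_slice ht)) (by norm_num) (h.hilbert_deriv_two t ht)
  rw [h.hilbert_zero t ht] at this
  norm_num at this
  exact this

theorem tendsto_hilbert_sub (h : NormalizedSolution cl cω Ω) :
    Tendsto (fun x => hilbertTransform (Ω 0) x - 2) (𝓝[≠] 0) (𝓝 0) := by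
  obtain ⟨A, B, hf⟩ := h.solution.exists_holderSq_slice le_rfl
  have hc : Continuous fun x => hilbertTransform (Ω 0) x - 2 :=
    hf.continuous_hilbertTransform.sub continuous_const
  have := (hc.tendsto 0).mono_left (nhdsWithin_le_nhds (s := {0}ᶜ))
  rwa [h.hilbert_zero 0 le_rfl, sub_self] at this

theorem tendsto_slice_zero (h : NormalizedSolution cl cω Ω) :
    Tendsto (Ω 0) (𝓝[≠] 0) (𝓝 0) := by
  obtain ⟨A, B, hf⟩ := h.solution.exists_holderSq_slice le_rfl
  have := (hf.continuous.tendsto 0).mono_left (nhdsWithin_le_nhds (s := {0}ᶜ))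
  rwa [h.zero_zero] at this

/-- Divide the real part of the explicit formula by `x²` and let `x → 0`. The left side tends to `2
L² E²`, the right to `2 E`: the `Ω₀²` term drops out because `Ω₀ = o(x²)`. -/
theorem dilation_sq (h : NormalizedSolution cl cω Ω) {t : ℝ} (ht : 0 ≤ t) :
    Real.exp (ratePrimitive cl t) ^ 2 * Real.exp (-t) = 1 := by
  set L := Real.exp (ratePrimitive cl t) with hL
  have hL0 : 0 < L := Real.exp_pos _
  set E := Real.exp (-t) with hE
  have hE0 : 0 < E := Real.exp_pos _
  set α := fun x => hilbertTransform (Ω 0) x - 2 with hα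
  have hα0 : Tendsto α (𝓝[≠] 0) (𝓝 0) := h.tendsto_hilbert_sub
  have hα2 : Tendsto (fun x => α x / x ^ 2) (𝓝[≠] 0) (𝓝 2) := h.hilbert_expansion le_rfl
  have hb := h.tendsto_slice_zero
  have hmul : Tendsto (fun x => L * x) (𝓝[≠] 0) (𝓝[≠] 0) := by
    refine tendsto_nhdsWithin_iff.2 ⟨?_, ?_⟩
    · have : Continuous fun x : ℝ => L * x := by fun_prop
      simpa using (this.tendsto 0).mono_left (nhdsWithin_le_nhds (s := {0}ᶜ))
    · filter_upwards [self_mem_nhdsWithin] with x hx using mul_ne_zero hL0.ne' hx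
  have h1 := ((h.hilbert_expansion ht).comp hmul).const_mul (L ^ 2)
  have hP : Tendsto (fun x => E - (1 - E) * α x / 2) (𝓝[≠] 0) (𝓝 E) := by
    simpa using ((hα0.const_mul (1 - E)).div_const 2).const_sub E
  have hD : Tendsto (fun x => (E - (1 - E) * α x / 2) ^ 2 + ((1 - E) * Ω 0 x / 2) ^ 2)
      (𝓝[≠] 0) (𝓝 (E ^ 2)) := by
    simpa using (hP.pow 2).add (((hb.const_mul (1 - E)).div_const 2).pow 2)
  have h2 := h1.mul hD
  have h3 : Tendsto (fun x => (E - (1 - E) * α x / 2) * (α x / x ^ 2) -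
      (1 - E) * (Ω 0 x * (Ω 0 x / x ^ 2)) / 2) (𝓝[≠] 0) (𝓝 (E * 2)) := by
    simpa using (hP.mul hα2).sub
      (((hb.mul h.tendsto_div_sq).const_mul (1 - E)).div_const 2)
  have h4 := tendsto_nhds_unique h2 (h3.congr' ?_)
  · have : E * (L ^ 2 * E) = E * 1 := by linarith
    exact mul_left_cancel₀ hE0.ne' this
  · filter_upwards [self_mem_nhdsWithin] with x hx
    have hx0 : x ≠ 0 := hx
    obtain ⟨-, -, e⟩ := h.solution.explicit_formula_parts h.zero_zero h.hilbert_zero ht x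
    rw [← hL, ← hE] at e
    simp only [Function.comp]
    have e2 : L ^ 2 * ((hilbertTransform (Ω t) (L * x) - 2) / (L * x) ^ 2) =
        (hilbertTransform (Ω t) (L * x) - 2) / x ^ 2 := by field_simp
    rw [e2, div_mul_eq_mul_div, e]
    simp only [hα]
    field_simp

theorem dilation_eq (h : NormalizedSolution cl cω Ω) {t : ℝ} (ht : 0 ≤ t) :
    Real.exp (ratePrimitive cl t) = Real.exp (t / 2) := by
  have h1 := h.dilation_sq ht
  rw [← Real.exp_nat_mul, ← Real.exp_add, Real.exp_eq_one_iff] at h1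
  congr 1
  push_cast at h1
  linarith

theorem cl_eq (h : NormalizedSolution cl cω Ω) {t : ℝ} (ht : 0 ≤ t) : cl t = 1 / 2 := by
  have h1 := (hasDerivAt_ratePrimitive h.solution.continuousOn_cl t).hasDerivWithinAt
    (s := Ici t)
  have h2 := ((hasDerivAt_id t).div_const 2).hasDerivWithinAt (s := Ici t)
  have h3 := h2.congr (fun s hs => Real.exp_injective (h.dilation_eq (ht.trans hs)))
    (Real.exp_injective (h.dilation_eq ht))
  have h4 := (uniqueDiffOn_Ici t t self_mem_Ici).eq_deriv _ h1 h3
  rwa [max_eq_left ht] at h4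

/-! ### Pointwise and locally uniform limits. -/

/-- The explicit formula in the variables `X = e^{t/2} x`, normalized by `e^{-t}`. -/
theorem profile_formula (h : NormalizedSolution cl cω Ω) {t : ℝ} (ht : 0 ≤ t) {X : ℝ}
    (hX : X ≠ 0) :
    let E := Real.exp (-t)
    let x := Real.exp (-(t / 2)) * X
    let a := X ^ 2 * ((hilbertTransform (Ω 0) x - 2) / x ^ 2)
    let b := X ^ 2 * (Ω 0 x / x ^ 2)
    let D := (1 - (1 - E) * a / 2) ^ 2 + ((1 - E) * b / 2) ^ 2
    0 < D ∧ Ω t X * D = b ∧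
      (hilbertTransform (Ω t) X - 2) * D = (1 - (1 - E) * a / 2) * a - (1 - E) * b ^ 2 / 2 := by
  intro E x a b D
  have hE : 0 < E := Real.exp_pos _
  have hx2 : x ^ 2 = E * X ^ 2 := by
    simp only [x, E, mul_pow, ← Real.exp_nat_mul]
    congr 2; push_cast; ring
  have hXx : Real.exp (ratePrimitive cl t) * x = X := by
    rw [h.dilation_eq ht]
    simp only [x]
    rw [← mul_assoc, ← Real.exp_add]; simp
  obtain ⟨h1, h2, h3⟩ := h.solution.explicit_formula_parts h.zero_zero h.hilbert_zero ht x
  rw [hXx] at h2 h3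
  have ha : hilbertTransform (Ω 0) x - 2 = E * a := by
    simp only [a]; rw [hx2]; field_simp
  have hb : Ω 0 x = E * b := by
    simp only [b]; rw [hx2]; field_simp
  change 0 < (E - (1 - E) * (hilbertTransform (Ω 0) x - 2) / 2) ^ 2 +
    ((1 - E) * Ω 0 x / 2) ^ 2 at h1
  change Ω t X * ((E - (1 - E) * (hilbertTransform (Ω 0) x - 2) / 2) ^ 2 +
    ((1 - E) * Ω 0 x / 2) ^ 2) = E * Ω 0 x at h2
  change (hilbertTransform (Ω t) X - 2) * ((E - (1 - E) * (hilbertTransform (Ω 0) x - 2) / 2) ^ 2 +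
    ((1 - E) * Ω 0 x / 2) ^ 2) = (E - (1 - E) * (hilbertTransform (Ω 0) x - 2) / 2) *
      (hilbertTransform (Ω 0) x - 2) - (1 - E) * Ω 0 x ^ 2 / 2 at h3
  rw [ha, hb] at h1 h2 h3
  have e : (E - (1 - E) * (E * a) / 2) ^ 2 + ((1 - E) * (E * b) / 2) ^ 2 = E ^ 2 * D := by
    simp only [D]; ring
  rw [e] at h1 h2 h3
  have hE2 : E ^ 2 ≠ 0 := by positivity
  refine ⟨pos_of_mul_pos_right h1 (by positivity), ?_, ?_⟩
  · refine mul_left_cancel₀ hE2 ?_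
    linarith
  · refine mul_left_cancel₀ hE2 ?_
    linarith

theorem tendsto_contraction {X : ℝ} (hX : X ≠ 0) :
    Tendsto (fun t : ℝ => Real.exp (-(t / 2)) * X) atTop (𝓝[≠] 0) := by
  refine tendsto_nhdsWithin_iff.2 ⟨?_, Eventually.of_forall fun t =>
    mul_ne_zero (Real.exp_pos _).ne' hX⟩
  have : Tendsto (fun t : ℝ => Real.exp (-(t / 2))) atTop (𝓝 0) :=
    Real.tendsto_exp_neg_atTop_nhds_zero.comp (tendsto_id.atTop_div_const two_pos)
  simpa using this.mul_const X

/-- In `profile_formula`, `a → 2 X²`, `b → 0` and `E → 0`, so `D → (1 - X²)²`, nonzero off `±1`. The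
origin is separate because the expansions live on its punctured neighbourhood. -/
theorem tendsto_pointwise (h : NormalizedSolution cl cω Ω) {X : ℝ} (h1 : X ≠ 1) (h2 : X ≠ -1) :
    Tendsto (fun t => Ω t X) atTop (𝓝 0) ∧
      Tendsto (fun t => hilbertTransform (Ω t) X) atTop (𝓝 (2 / (1 - X ^ 2))) := by
  rcases eq_or_ne X 0 with rfl | hX
  · constructor
    · refine tendsto_const_nhds.congr' ?_
      filter_upwards [eventually_ge_atTop 0] with t ht
      have := h.odd_slice ht 0
      rw [neg_zero] at this; linarith
    · refine tendsto_const_nhds.congr' ?_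
      filter_upwards [eventually_ge_atTop 0] with t ht
      rw [h.hilbert_zero t ht]; norm_num
  have hx := tendsto_contraction hX
  have hE : Tendsto (fun t : ℝ => 1 - Real.exp (-t)) atTop (𝓝 1) := by
    simpa using Real.tendsto_exp_neg_atTop_nhds_zero.const_sub 1
  have ha : Tendsto _ atTop (𝓝 (X ^ 2 * 2)) :=
    (((h.hilbert_expansion le_rfl).comp hx).const_mul (X ^ 2))
  have hb : Tendsto _ atTop (𝓝 (X ^ 2 * 0)) := ((h.tendsto_div_sq.comp hx).const_mul (X ^ 2))
  rw [mul_zero] at hb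
  have hp := ((hE.mul ha).div_const 2).const_sub 1
  have hq := (hE.mul hb).div_const 2
  have hD := (hp.pow 2).add (hq.pow 2)
  have hne : (1 - X ^ 2) ≠ 0 := by
    have : 1 - X ^ 2 = (1 - X) * (1 + X) := by ring
    rw [this]
    exact mul_ne_zero (fun h => h1 (by linarith)) (fun h => h2 (by linarith))
  rw [show (1 - 1 * (X ^ 2 * 2) / 2) ^ 2 + (1 * 0 / 2) ^ 2 = (1 - X ^ 2) ^ 2 by ring] at hD
  have hD0 : (1 - X ^ 2) ^ 2 ≠ 0 := pow_ne_zero 2 hne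
  constructor
  · have := hb.div hD hD0
    rw [zero_div] at this
    refine this.congr' ?_
    filter_upwards [eventually_ge_atTop 0] with t ht
    obtain ⟨e1, e2, -⟩ := h.profile_formula ht hX
    exact (eq_div_of_mul_eq e1.ne' e2).symm
  · have := (((hp.mul ha).sub ((hE.mul (hb.pow 2)).div_const 2)).div hD hD0).add_const 2
    have e : ((1 - 1 * (X ^ 2 * 2) / 2) * (X ^ 2 * 2) - 1 * 0 ^ 2 / 2) / (1 - X ^ 2) ^ 2 + 2 =
        2 / (1 - X ^ 2) := by
      field_simp
      ring
    rw [e] at this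
    refine this.congr' ?_
    filter_upwards [eventually_ge_atTop 0] with t ht
    obtain ⟨e1, -, e2⟩ := h.profile_formula ht hX
    have := eq_div_of_mul_eq e1.ne' e2
    exact (eq_sub_iff_add_eq.1 (this.symm))

theorem eventually_abs_le (h : NormalizedSolution cl cω Ω) {δ R ε : ℝ} (hδ : 0 < δ) (hε : 0 < ε) :
    ∀ᶠ t in atTop, ∀ X, 0 < X → X ≤ R → δ ≤ |X - 1| → |Ω t X| / X ≤ ε := by
  rcases le_or_gt R 0 with hR | hR
  · exact Eventually.of_forall fun t X h1 h2 => by linarith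
  -- The second bound keeps the perturbation of `1 - X²` below `δ / 2`, so `D ≥ δ² / 4`. The first
  -- turns `|Ω| D ≤ X² η` into `|Ω| ≤ ε X`.
  set η := min (ε * δ ^ 2 / (4 * R)) (δ / (4 * R ^ 2)) with hη
  have hη0 : 0 < η := by positivity
  have hη1 : η * R ≤ ε * δ ^ 2 / 4 := by
    have : η ≤ ε * δ ^ 2 / (4 * R) := min_le_left _ _
    rw [le_div_iff₀ (by positivity)] at this
    linarith
  have hη2 : R ^ 2 * η ≤ δ / 4 := by
    have : η ≤ δ / (4 * R ^ 2) := min_le_right _ _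
    rw [le_div_iff₀ (by positivity)] at this
    linarith
  have ha := (Metric.tendsto_nhds.1 (h.hilbert_expansion le_rfl)) η hη0
  have hb := (Metric.tendsto_nhds.1 h.tendsto_div_sq) η hη0
  obtain ⟨r, hr0, hr⟩ := Metric.eventually_nhds_iff_ball.1
    (eventually_nhdsWithin_iff.1 (ha.and hb))
  have hx := (Real.tendsto_exp_neg_atTop_nhds_zero.comp
    (tendsto_id.atTop_div_const (two_pos (α := ℝ)))).mul_const R
  rw [zero_mul] at hx
  have hE := Real.tendsto_exp_neg_atTop_nhds_zero.eventually_lt_const hη0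
  filter_upwards [eventually_ge_atTop 0, hx.eventually_lt_const hr0, hE] with t ht htr htE X hX hXR
    hXδ
  obtain ⟨-, e, -⟩ := h.profile_formula ht hX.ne'
  set E := Real.exp (-t) with hEdef
  set x := Real.exp (-(t / 2)) * X with hxdef
  have hE0 : 0 < E := Real.exp_pos _
  have hE1 : E ≤ 1 := Real.exp_le_one_iff.2 (by linarith)
  have hxpos : 0 < x := mul_pos (Real.exp_pos _) hX
  have hxr : x < r := by
    refine lt_of_le_of_lt ?_ htr
    simp only [Function.comp, id]
    rw [hxdef]
    gcongr
  obtain ⟨h1, h2⟩ := hr x (by simpa [abs_of_pos hxpos] using hxr) hxpos.ne'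
  rw [Real.dist_eq] at h1 h2
  rw [sub_zero] at h2
  set a := (hilbertTransform (Ω 0) x - 2) / x ^ 2
  set b := Ω 0 x / x ^ 2
  change Ω t X * ((1 - (1 - E) * (X ^ 2 * a) / 2) ^ 2 + ((1 - E) * (X ^ 2 * b) / 2) ^ 2)
    = X ^ 2 * b at e
  have hX2 : X ^ 2 ≤ R ^ 2 := by gcongr
  have hp : δ / 2 ≤ |1 - (1 - E) * (X ^ 2 * a) / 2| := by
    have s1 : 1 - (1 - E) * (X ^ 2 * a) / 2 =
        (1 - X ^ 2) - X ^ 2 * ((1 - E) * (a - 2) / 2 - E) := by ring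
    have s2 : δ ≤ |1 - X ^ 2| := by
      rw [show 1 - X ^ 2 = -((X - 1) * (X + 1)) by ring, abs_neg, abs_mul,
        abs_of_pos (by linarith : 0 < X + 1)]
      nlinarith
    have s3 : |(1 - E) * (a - 2) / 2 - E| ≤ 2 * η := by
      refine (abs_sub _ _).trans ?_
      rw [abs_div, abs_mul, abs_of_nonneg (by linarith : 0 ≤ 1 - E), abs_of_pos hE0, abs_two]
      have : (1 - E) * |a - 2| ≤ 1 * η := by
        gcongr
        linarith
      linarith
    have s4 : |X ^ 2 * ((1 - E) * (a - 2) / 2 - E)| ≤ δ / 2 := by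
      rw [abs_mul, abs_of_nonneg (sq_nonneg X)]
      calc X ^ 2 * |(1 - E) * (a - 2) / 2 - E| ≤ R ^ 2 * (2 * η) := by gcongr
        _ ≤ δ / 2 := by linarith
    rw [s1]
    have := abs_sub_abs_le_abs_sub (1 - X ^ 2) (X ^ 2 * ((1 - E) * (a - 2) / 2 - E))
    linarith
  have hD : δ ^ 2 / 4 ≤ (1 - (1 - E) * (X ^ 2 * a) / 2) ^ 2 + ((1 - E) * (X ^ 2 * b) / 2) ^ 2 := by
    rw [← sq_abs (1 - (1 - E) * (X ^ 2 * a) / 2)]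
    have : (δ / 2) ^ 2 ≤ |1 - (1 - E) * (X ^ 2 * a) / 2| ^ 2 := by gcongr
    nlinarith [sq_nonneg ((1 - E) * (X ^ 2 * b) / 2)]
  set D := (1 - (1 - E) * (X ^ 2 * a) / 2) ^ 2 + ((1 - E) * (X ^ 2 * b) / 2) ^ 2
  have hfin : |Ω t X| * D ≤ X ^ 2 * η := by
    have hD0 : 0 ≤ D := le_trans (by positivity) hD
    rw [← abs_of_nonneg hD0, ← abs_mul, e, abs_mul, abs_of_nonneg (sq_nonneg X)]
    gcongr
  rw [div_le_iff₀ hX]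
  have t1 : |Ω t X| * (δ ^ 2 / 4) ≤ X ^ 2 * η :=
    (mul_le_mul_of_nonneg_left hD (abs_nonneg _)).trans hfin
  have t2 : X ^ 2 * η ≤ X * (ε * δ ^ 2 / 4) := by
    calc X ^ 2 * η = X * (η * X) := by ring
      _ ≤ X * (η * R) := by gcongr
      _ ≤ _ := by gcongr
  have t3 : |Ω t X| * (δ ^ 2 / 4) ≤ ε * X * (δ ^ 2 / 4) := by linarith
  exact le_of_mul_le_mul_right t3 (by positivity)

end NormalizedSolution

/-! ### Concentration of mass and weak convergence. -/

/-- Positive densities on `(0,∞)` of fixed mass, uniformly vanishing away from `1` on bounded sets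
and tight at infinity, converge to a Dirac mass at `1`. -/
theorem tendsto_setIntegral_mul_of_concentrates {w : ℝ → ℝ → ℝ} {m : ℝ}
    (hnonneg : ∀ᶠ t in atTop, ∀ y, 0 < y → 0 ≤ w t y)
    (hint : ∀ᶠ t in atTop, IntegrableOn (w t) (Ioi 0))
    (hmass : ∀ᶠ t in atTop, ∫ y in Ioi 0, w t y = m)
    (hunif : ∀ δ R ε : ℝ, 0 < δ → 0 < ε →
      ∀ᶠ t in atTop, ∀ y, 0 < y → y ≤ R → δ ≤ |y - 1| → w t y ≤ ε)
    (htight : ∀ ε : ℝ, 0 < ε → ∃ R, 0 < R ∧ ∀ᶠ t in atTop, ∫ y in Ioi R, w t y ≤ ε)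
    {ψ : ℝ → ℝ} (hψ : Continuous ψ) {K : ℝ} (hK : ∀ y, |ψ y| ≤ K) :
    Tendsto (fun t => ∫ y in Ioi 0, w t y * ψ y) atTop (𝓝 (m * ψ 1)) := by
  have hK0 : 0 ≤ K := (abs_nonneg _).trans (hK 0)
  rw [Metric.tendsto_nhds]
  intro ε hε
  set ε₁ := ε / (4 * (|m| + 1)) with hε₁
  have hε₁0 : 0 < ε₁ := by positivity
  obtain ⟨δ, hδ0, hδ⟩ := Metric.continuous_iff.1 hψ 1 ε₁ hε₁0
  set ε₂ := ε / (8 * (K + 1)) with hε₂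
  have hε₂0 : 0 < ε₂ := by positivity
  obtain ⟨R, hR0, hR⟩ := htight ε₂ hε₂0
  have h3 := hunif δ R (ε₂ / R) hδ0 (by positivity)
  filter_upwards [hnonneg, hint, hmass, hR, h3] with t hn hi hm ht hu
  have hi2 : IntegrableOn (fun y => w t y * ψ y) (Ioi 0) :=
    hi.mul_bdd hψ.aestronglyMeasurable (Eventually.of_forall hK)
  have hc : IntegrableOn (fun y => w t y * ψ 1) (Ioi 0) := hi.mul_const _
  have hbR : IntegrableOn (fun y => (Ioi R).indicator (w t) y) (Ioi 0) :=
    hi.indicator measurableSet_Ioi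
  have hbc : IntegrableOn (fun y => (Ioc 0 R).indicator (fun _ => ε₂ / R) y) (Ioi 0) := by
    rw [IntegrableOn, integrable_indicator_iff measurableSet_Ioc]
    rw [IntegrableOn, Measure.restrict_restrict measurableSet_Ioc,
      inter_eq_left.2 Ioc_subset_Ioi_self]
    exact integrable_const _
  have hsum : IntegrableOn (fun y => (Ioc 0 R).indicator (fun _ => ε₂ / R) y +
      (Ioi R).indicator (w t) y) (Ioi 0) := hbc.add hbR
  -- Near `1`, continuity of `ψ` gives the `ε₁` term. Elsewhere up to `R`, `w ≤ ε₂ / R`, whose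
  -- integral over `(0, R]` is `ε₂`; beyond `R`, tightness bounds the mass by `ε₂`.
  have key : ∀ y ∈ Ioi (0:ℝ), |w t y * ψ y - w t y * ψ 1| ≤
      ε₁ * w t y + 2 * K * ((Ioc 0 R).indicator (fun _ => ε₂ / R) y +
        (Ioi R).indicator (w t) y) := by
    intro y hy
    have hy0 : (0:ℝ) < y := hy
    have hw := hn y hy0
    have hdiff : |ψ y - ψ 1| ≤ 2 * K := (abs_sub _ _).trans (by linarith [hK y, hK 1])
    rw [← mul_sub, abs_mul, abs_of_nonneg hw]
    have i1 : 0 ≤ (Ioc 0 R).indicator (fun _ => ε₂ / R) y :=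
      indicator_nonneg (fun _ _ => by positivity) _
    have i2 : 0 ≤ (Ioi R).indicator (w t) y :=
      indicator_nonneg (fun z hz => hn z (hR0.trans hz)) _
    by_cases h1 : |y - 1| < δ
    · have := (hδ y (by rwa [Real.dist_eq])).le
      rw [Real.dist_eq] at this
      have h4 : w t y * |ψ y - ψ 1| ≤ w t y * ε₁ := by gcongr
      have h5 : 0 ≤ 2 * K * ((Ioc 0 R).indicator (fun _ => ε₂ / R) y +
        (Ioi R).indicator (w t) y) := by positivity
      linarith
    · push Not at h1
      have h6 : w t y ≤ (Ioc 0 R).indicator (fun _ => ε₂ / R) y + (Ioi R).indicator (w t) y := by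
        rcases le_or_gt y R with h2 | h2
        · rw [indicator_of_mem (show y ∈ Ioc 0 R from ⟨hy0, h2⟩)]
          linarith [hu y hy0 h2 h1]
        · rw [indicator_of_mem (show y ∈ Ioi R from h2)]
          linarith
      calc w t y * |ψ y - ψ 1| ≤ ((Ioc 0 R).indicator (fun _ => ε₂ / R) y +
            (Ioi R).indicator (w t) y) * (2 * K) := by gcongr
        _ ≤ _ := by
            have := mul_nonneg hε₁0.le hw
            linarith
  have e1 : ∫ y in Ioi 0, (Ioi R).indicator (w t) y = ∫ y in Ioi R, w t y := by
    rw [setIntegral_indicator measurableSet_Ioi, inter_eq_right.2 (Ioi_subset_Ioi hR0.le)]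
  have e2 : ∫ y in Ioi 0, (Ioc 0 R).indicator (fun _ => ε₂ / R) y = ε₂ := by
    rw [setIntegral_indicator measurableSet_Ioc, inter_eq_right.2 Ioc_subset_Ioi_self]
    simp [hR0.le]
    field_simp
  have hsplit : m * ψ 1 = ∫ y in Ioi 0, w t y * ψ 1 := by rw [integral_mul_const, hm]
  rw [Real.dist_eq, hsplit, ← integral_sub hi2 hc]
  have hm0 : ε₁ * m ≤ ε / 4 := by
    have : ε₁ * (|m| + 1) = ε / 4 := by rw [hε₁]; field_simp
    nlinarith [le_abs_self m]
  have hK1 : K * ε₂ ≤ ε / 8 := by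
    have : (K + 1) * ε₂ = ε / 8 := by rw [hε₂]; field_simp
    nlinarith
  have hK2 : 2 * K * (ε₂ + ∫ y in Ioi R, w t y) ≤ 2 * K * (ε₂ + ε₂) := by gcongr
  calc |∫ y in Ioi 0, (w t y * ψ y - w t y * ψ 1)|
      ≤ ∫ y in Ioi 0, |w t y * ψ y - w t y * ψ 1| := abs_integral_le_integral_abs
    _ ≤ ∫ y in Ioi 0, (ε₁ * w t y + 2 * K * ((Ioc 0 R).indicator (fun _ => ε₂ / R) y +
          (Ioi R).indicator (w t) y)) :=
        setIntegral_mono_on (hi2.sub hc).abs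
          ((hi.const_mul _).add (hsum.const_mul _)) measurableSet_Ioi key
    _ = ε₁ * m + 2 * K * (ε₂ + ∫ y in Ioi R, w t y) := by
        rw [integral_add (hi.const_mul _) (hsum.const_mul _), integral_const_mul,
          integral_const_mul, integral_add hbc hbR, hm, e1, e2]
    _ < ε := by linarith

namespace NormalizedSolution

variable {cl cω : ℝ → ℝ} {Ω : ℝ → ℝ → ℝ}

theorem symmQuot_zero (h : NormalizedSolution cl cω Ω) {t : ℝ} (ht : 0 ≤ t) (y : ℝ) :
    symmQuot (Ω t) 0 y = 2 * (-Ω t y / y) := by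
  rw [symmQuot, zero_sub, zero_add, h.odd_slice ht]; ring

theorem density_nonneg (h : NormalizedSolution cl cω Ω) {t : ℝ} (ht : 0 ≤ t) {y : ℝ}
    (hy : 0 < y) : 0 ≤ -Ω t y / y :=
  div_nonneg (neg_nonneg.2 (h.nonpos_slice ht hy)) hy.le

theorem integrableOn_density (h : NormalizedSolution cl cω Ω) {t : ℝ} (ht : 0 ≤ t) :
    IntegrableOn (fun y => -Ω t y / y) (Ioi 0) := by
  obtain ⟨A, B, hf⟩ := h.solution.exists_holderSq_slice ht
  refine IntegrableOn.congr_fun ((hf.integrableOn_symmQuot 0).div_const 2) (fun y _ => ?_)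
    measurableSet_Ioi
  rw [h.symmQuot_zero ht]; ring

/-- By oddness, `H Ω (0)` is `2 / π` times the mass of this density, so the normalization conserves
that mass. -/
theorem integral_density (h : NormalizedSolution cl cω Ω) {t : ℝ} (ht : 0 ≤ t) :
    ∫ y in Ioi 0, -Ω t y / y = Real.pi := by
  obtain ⟨A, B, hf⟩ := h.solution.exists_holderSq_slice ht
  have h1 := hf.hilbertTransform_eq 0
  simp_rw [h.symmQuot_zero ht] at h1
  rw [h.hilbert_zero t ht, integral_const_mul] at h1
  have := Real.pi_pos
  generalize ∫ y in Ioi 0, -Ω t y / y = I at h1 ⊢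
  field_simp at h1
  linarith

theorem cauchyTransform_re (h : NormalizedSolution cl cω Ω) {t : ℝ} (ht : 0 ≤ t) {η : ℝ}
    (hη : 0 < η) : (cauchyTransform (Ω t) ⟨0, η⟩).re =
      (2 / Real.pi) * ∫ y in Ioi 0, -Ω t y / y * (y ^ 2 / (y ^ 2 + η ^ 2)) := by
  obtain ⟨A, B, hf⟩ := h.solution.exists_holderSq_slice ht
  rw [hf.cauchyTransform_re_eq_symmQuot (z := ⟨0, η⟩) hη]
  simp_rw [h.symmQuot_zero ht, mul_assoc]
  rw [integral_const_mul]
  ring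

theorem cauchyTransform_im (h : NormalizedSolution cl cω Ω) {t : ℝ} (ht : 0 ≤ t) {η : ℝ}
    (hη : 0 < η) : (cauchyTransform (Ω t) ⟨0, η⟩).im = 0 := by
  obtain ⟨A, B, hf⟩ := h.solution.exists_holderSq_slice ht
  rw [hf.cauchyTransform_im (z := ⟨0, η⟩) hη]
  have h1 := integral_neg_eq_self (fun y => Ω t y * η / ((0 - y) ^ 2 + η ^ 2)) volume
  have h2 : (fun y => Ω t (-y) * η / ((0 - -y) ^ 2 + η ^ 2)) =
      fun y => -(Ω t y * η / ((0 - y) ^ 2 + η ^ 2)) := by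
    ext y; rw [h.odd_slice ht]; ring
  rw [h2, integral_neg] at h1
  have h3 : ∫ y, Ω t y * η / ((0 - y) ^ 2 + η ^ 2) = 0 := by linarith
  change -(1 / Real.pi * ∫ y, Ω t y * η / ((0 - y) ^ 2 + η ^ 2)) = 0
  rw [h3, mul_zero, neg_zero]

theorem integrableOn_density_mul (h : NormalizedSolution cl cω Ω) {t : ℝ} (ht : 0 ≤ t) {k : ℝ → ℝ}
    (hk : Measurable k) (hk1 : ∀ y, |k y| ≤ 1) :
    IntegrableOn (fun y => -Ω t y / y * k y) (Ioi 0) :=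
  (h.integrableOn_density ht).mul_bdd hk.aestronglyMeasurable (Eventually.of_forall hk1)

theorem abs_div_add_le_one {a b : ℝ} (ha : 0 ≤ a) (hb : 0 ≤ b) : |a / (a + b)| ≤ 1 := by
  rw [abs_of_nonneg (by positivity)]
  exact div_le_one_of_le₀ (by linarith) (by positivity)

/-- The deficit from `2` is `(2 / π) ∫ w η² / (y² + η²)` with `w = -Ω₀ / y`. For `η ≤ 1` replace the
denominator by `1 + y²`; strict negativity of the data makes `κ` positive. -/
theorem exists_cauchyTransform_re_le (h : NormalizedSolution cl cω Ω) : ∃ κ > 0, ∀ η, 0 < η →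
    η ≤ 1 → (cauchyTransform (Ω 0) ⟨0, η⟩).re ≤ 2 - κ * η ^ 2 := by
  have hpi := Real.pi_pos
  have hI1 : IntegrableOn (fun y => -Ω 0 y / y * (1 / (1 + y ^ 2))) (Ioi 0) :=
    h.integrableOn_density_mul le_rfl (by fun_prop)
      fun y => abs_div_add_le_one zero_le_one (sq_nonneg y)
  refine ⟨(2 / Real.pi) * ∫ y in Ioi 0, -Ω 0 y / y * (1 / (1 + y ^ 2)), ?_, fun η hη hη1 => ?_⟩
  · refine mul_pos (by positivity) ?_
    rw [setIntegral_pos_iff_support_of_nonneg_ae ?_ hI1]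
    · have : Function.support (fun y => -Ω 0 y / y * (1 / (1 + y ^ 2))) ∩ Ioi 0 = Ioi 0 := by
        refine inter_eq_right.2 fun y hy => ?_
        have hy0 : (0:ℝ) < y := hy
        have := h.neg y hy
        have h1 : 0 < -Ω 0 y := by linarith
        exact ne_of_gt (by positivity)
      rw [this]; simp
    · filter_upwards [ae_restrict_mem measurableSet_Ioi] with y hy
      exact mul_nonneg (h.density_nonneg le_rfl hy) (by positivity)
  · rw [h.cauchyTransform_re le_rfl hη]
    have hI2 : IntegrableOn (fun y => -Ω 0 y / y * (y ^ 2 / (y ^ 2 + η ^ 2))) (Ioi 0) :=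
      h.integrableOn_density_mul le_rfl (by fun_prop)
        fun y => abs_div_add_le_one (sq_nonneg y) (sq_nonneg η)
    have h2 : (2:ℝ) = (2 / Real.pi) * ∫ y in Ioi 0, -Ω 0 y / y := by
      rw [h.integral_density le_rfl]; field_simp
    rw [le_sub_iff_add_le, mul_assoc, ← mul_add]
    nth_rewrite 2 [h2]
    gcongr
    rw [← integral_mul_const, ← integral_add hI2 (hI1.mul_const _)]
    refine setIntegral_mono_on (hI2.add (hI1.mul_const _)) (h.integrableOn_density le_rfl)
      measurableSet_Ioi fun y hy => ?_
    have hw := h.density_nonneg le_rfl hy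
    have hy0 : (0:ℝ) < y := hy
    have : y ^ 2 / (y ^ 2 + η ^ 2) + 1 / (1 + y ^ 2) * η ^ 2 ≤ 1 := by
      have : 1 / (1 + y ^ 2) * η ^ 2 ≤ η ^ 2 / (y ^ 2 + η ^ 2) := by
        rw [div_mul_eq_mul_div, one_mul]
        exact div_le_div_of_nonneg_left (by positivity) (by positivity) (by nlinarith)
      have h3 : y ^ 2 / (y ^ 2 + η ^ 2) + η ^ 2 / (y ^ 2 + η ^ 2) = 1 := by
        field_simp
      linarith
    calc _ = -Ω 0 y / y * (y ^ 2 / (y ^ 2 + η ^ 2) + 1 / (1 + y ^ 2) * η ^ 2) := by ring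
      _ ≤ -Ω 0 y / y * 1 := by gcongr
      _ = _ := mul_one _

/-- The weight `y² / (y² + R²)` is at least `1/2` for `y > R`. -/
theorem setIntegral_density_le (h : NormalizedSolution cl cω Ω) {t : ℝ} (ht : 0 ≤ t) {R : ℝ}
    (hR : 0 < R) :
    ∫ y in Ioi R, -Ω t y / y ≤ Real.pi * (cauchyTransform (Ω t) ⟨0, R⟩).re := by
  have hpi := Real.pi_pos
  rw [h.cauchyTransform_re ht hR, ← mul_assoc, mul_div_cancel₀ _ hpi.ne', ← integral_const_mul]
  have hI2 : IntegrableOn (fun y => -Ω t y / y * (y ^ 2 / (y ^ 2 + R ^ 2))) (Ioi 0) :=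
    h.integrableOn_density_mul ht (by fun_prop)
      fun y => abs_div_add_le_one (sq_nonneg y) (sq_nonneg R)
  have hsub : Ioi R ⊆ Ioi 0 := Ioi_subset_Ioi hR.le
  calc ∫ y in Ioi R, -Ω t y / y
      ≤ ∫ y in Ioi R, 2 * (-Ω t y / y * (y ^ 2 / (y ^ 2 + R ^ 2))) := by
        refine setIntegral_mono_on ((h.integrableOn_density ht).mono_set hsub)
          (IntegrableOn.mono_set (hI2.const_mul 2) hsub) measurableSet_Ioi fun y hy => ?_
        have hy' : R < y := hy
        have hw := h.density_nonneg ht (hR.trans hy)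
        have : 1 ≤ 2 * (y ^ 2 / (y ^ 2 + R ^ 2)) := by
          rw [← mul_div_assoc, le_div_iff₀ (by positivity)]; nlinarith
        nlinarith
    _ ≤ ∫ y in Ioi 0, 2 * (-Ω t y / y * (y ^ 2 / (y ^ 2 + R ^ 2))) := by
        refine setIntegral_mono_set (hI2.const_mul 2) ?_ hsub.eventuallyLE
        filter_upwards [ae_restrict_mem measurableSet_Ioi] with y hy
        have := h.density_nonneg ht hy
        simp only [Pi.zero_apply]
        positivity

/-- At height `R` the Cauchy transform comes from the data at height `η = e^{-t/2} R`. The quadratic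
deficit there bounds the Riccati denominator below by `E κ R² / 4`, while the numerator is at most
`2 E`. The factor `E` cancels, leaving a bound `8 / (κ R²)` uniform in large `t`. -/
theorem tight_density (h : NormalizedSolution cl cω Ω) {ε : ℝ} (hε : 0 < ε) :
    ∃ R, 0 < R ∧ ∀ᶠ t in atTop, ∫ y in Ioi R, -Ω t y / y ≤ ε := by
  have hpi := Real.pi_pos
  obtain ⟨κ, hκ, hle⟩ := h.exists_cauchyTransform_re_le
  -- `R` solves `π · 8 / (κ R²) = ε`.
  refine ⟨√(8 * Real.pi / (κ * ε)), by positivity, ?_⟩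
  set R := √(8 * Real.pi / (κ * ε)) with hR
  have hR0 : 0 < R := by positivity
  have hR2 : R ^ 2 * (κ * ε) = 8 * Real.pi := by
    rw [hR, Real.sq_sqrt (by positivity)]; field_simp
  have hx := (Real.tendsto_exp_neg_atTop_nhds_zero.comp
    (tendsto_id.atTop_div_const (two_pos (α := ℝ)))).mul_const R
  rw [zero_mul] at hx
  have hEl := Real.tendsto_exp_neg_atTop_nhds_zero.eventually_lt_const
    (show (0:ℝ) < 1 / 2 by norm_num)
  filter_upwards [eventually_ge_atTop 0, hx.eventually_lt_const one_pos, hEl] with t ht hη hE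
  refine (h.setIntegral_density_le ht hR0).trans ?_
  simp only [Function.comp, id] at hη
  set η := Real.exp (-(t / 2)) * R with hηdef
  have hη0 : 0 < η := mul_pos (Real.exp_pos _) hR0
  set E := Real.exp (-t) with hEdef
  have hE0 : 0 < E := Real.exp_pos _
  have hη2 : η ^ 2 = E * R ^ 2 := by
    simp only [hηdef, hEdef, mul_pow, ← Real.exp_nat_mul]
    congr 2; push_cast; ring
  have hγ := hle η hη0 hη.le
  have e := h.solution.explicit_formula_upper ht (z := ⟨0, η⟩) hη0
  have hz : (Real.exp (ratePrimitive cl t) : ℂ) * (⟨0, η⟩ : ℂ) = ⟨0, R⟩ := by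
    have : Real.exp (ratePrimitive cl t) * η = R := by
      rw [h.dilation_eq ht, hηdef, ← mul_assoc, ← Real.exp_add]; simp
    rw [Complex.ext_iff, Complex.re_ofReal_mul, Complex.im_ofReal_mul]
    exact ⟨mul_zero _, this⟩
  have hS : IsDynamicRescalingSolution.growthIntegral cω t = 1 - E := by
    have := h.solution.exp_ratePrimitive_eq h.zero_zero h.hilbert_zero ht
    rw [h.solution.exp_ratePrimitive_cω h.zero_zero h.hilbert_zero t] at this
    linarith
  set γ := (cauchyTransform (Ω 0) ⟨0, η⟩).re with hγdef
  have hG0 : cauchyTransform (Ω 0) ⟨0, η⟩ = (γ : ℂ) := by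
    rw [Complex.ext_iff]
    exact ⟨by simp [hγdef], by simp [h.cauchyTransform_im le_rfl hη0]⟩
  set G := (cauchyTransform (Ω t) ⟨0, R⟩).re with hGdef
  have hG : cauchyTransform (Ω t) ⟨0, R⟩ = (G : ℂ) := by
    rw [Complex.ext_iff]
    exact ⟨by simp [hGdef], by simp [h.cauchyTransform_im ht hR0]⟩
  rw [hz, hG, hG0, h.solution.exp_ratePrimitive_cω h.zero_zero h.hilbert_zero t, hS, ← hEdef] at e
  have e' : G * (1 - (1 - E) * γ / 2) = E * γ := by exact_mod_cast e
  have hG1 : 0 ≤ G := by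
    have h1 := h.setIntegral_density_le ht hR0
    have h2 : 0 ≤ ∫ y in Ioi R, -Ω t y / y :=
      setIntegral_nonneg measurableSet_Ioi fun y hy => h.density_nonneg ht (hR0.trans hy)
    exact nonneg_of_mul_nonneg_right (h2.trans h1) hpi
  have s1 : E * (κ * R ^ 2 / 4) ≤ 1 - (1 - E) * γ / 2 := by
    have : (1 - E) * γ ≤ (1 - E) * (2 - κ * (E * R ^ 2)) := by
      rw [← hη2]
      gcongr
      linarith
    have h4 : 1 / 2 * (κ * (E * R ^ 2)) ≤ (1 - E) * (κ * (E * R ^ 2)) := by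
      gcongr
      linarith
    linarith
  have s2 : γ ≤ 2 := by nlinarith [mul_pos hκ (pow_pos hη0 2)]
  have s3 : E * (G * (κ * R ^ 2 / 4)) ≤ E * 2 := by
    calc E * (G * (κ * R ^ 2 / 4)) = G * (E * (κ * R ^ 2 / 4)) := by ring
      _ ≤ G * (1 - (1 - E) * γ / 2) := by gcongr
      _ = E * γ := e'
      _ ≤ E * 2 := by gcongr
  have s4 : G * (κ * R ^ 2) ≤ 8 := by
    have := le_of_mul_le_mul_left s3 hE0
    linarith
  have s5 : Real.pi * G * (κ * R ^ 2) ≤ ε * (κ * R ^ 2) := by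
    calc Real.pi * G * (κ * R ^ 2) = Real.pi * (G * (κ * R ^ 2)) := by ring
      _ ≤ Real.pi * 8 := by gcongr
      _ = _ := by linarith
  exact le_of_mul_le_mul_right s5 (by positivity)

theorem tendsto_integral_mul (h : NormalizedSolution cl cω Ω) {φ : ℝ → ℝ} (hφ : Continuous φ)
    (hsupp : HasCompactSupport φ) :
    Tendsto (fun t => ∫ X, Ω t X * φ X) atTop (𝓝 (singularProfile φ)) := by
  -- Oddness folds the integral onto `(0, ∞)`; the factor `y` compensates the `1 / y` in the
  -- density, and `ψ 1 = φ 1 - φ (-1)`.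
  set ψ : ℝ → ℝ := fun y => y * (φ y - φ (-y)) with hψ
  have hψc : Continuous ψ := by fun_prop
  have hsupp' : HasCompactSupport fun y => φ (-y) :=
    hsupp.comp_homeomorph (Homeomorph.neg ℝ)
  have hψs : HasCompactSupport ψ := (hsupp.sub hsupp').mul_left
  obtain ⟨K, hK⟩ := hψs.exists_bound_of_continuous hψc
  have key := tendsto_setIntegral_mul_of_concentrates (w := fun t y => -Ω t y / y) (m := Real.pi)
    (by filter_upwards [eventually_ge_atTop 0] with t ht y hy using h.density_nonneg ht hy)
    (by filter_upwards [eventually_ge_atTop 0] with t ht using h.integrableOn_density ht)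
    (by filter_upwards [eventually_ge_atTop 0] with t ht using h.integral_density ht)
    (fun δ R ε hδ hε => by
      filter_upwards [h.eventually_abs_le (R := R) hδ hε] with t ht y h1 h2 h3
      refine le_trans ?_ (ht y h1 h2 h3)
      gcongr
      exact neg_le_abs _)
    (fun ε hε => h.tight_density hε) hψc hK
  have key2 := key.neg
  have e : -(Real.pi * ψ 1) = singularProfile φ := by
    simp [singularProfile, hψ]
  rw [e] at key2
  refine key2.congr' ?_
  filter_upwards [eventually_ge_atTop 0] with t ht
  obtain ⟨A, B, hf⟩ := h.solution.exists_holderSq_slice ht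
  have hI : Integrable fun X => Ω t X * φ X :=
    (hf.continuous.mul hφ).integrable_of_hasCompactSupport hsupp.mul_left
  rw [HolderSq.integral_eq_integral_Ioi_add hI, ← integral_neg]
  refine setIntegral_congr_fun measurableSet_Ioi fun y hy => ?_
  have hy0 : y ≠ 0 := ne_of_gt hy
  simp only [hψ]
  rw [h.odd_slice ht]
  field_simp
  ring

end NormalizedSolution

/-! ### The singular profile and the conclusion. -/

theorem singularProfileHilbert_eq {X : ℝ} (h1 : X ≠ 1) (h2 : X ≠ -1) :
    singularProfileHilbert X = 2 / (1 - X ^ 2) := by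
  have hpi := Real.pi_ne_zero
  have h3 : X - 1 ≠ 0 := sub_ne_zero.2 h1
  have h4 : X - -1 ≠ 0 := sub_ne_zero.2 h2
  have h5 : 1 - X ^ 2 ≠ 0 := by
    rw [show 1 - X ^ 2 = -((X - 1) * (X - -1)) by ring]
    exact neg_ne_zero.2 (mul_ne_zero h3 h4)
  rw [singularProfileHilbert, singularProfile]
  rw [sub_neg_eq_add] at *
  field_simp
  ring

theorem mainTheorem1 (Ω : ℝ → ℝ → ℝ) (cl cω : ℝ → ℝ) (Ω₀ : ℝ → ℝ)
    (hsol : IsDynamicRescalingSolution cl cω Ω)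
    (hinit : Ω 0 = Ω₀)
    (hsmooth : ContDiff ℝ ∞ Ω₀)
    (hodd : ∀ X : ℝ, Ω₀ (-X) = -Ω₀ X)
    (hdeg : deriv Ω₀ 0 = 0)
    (hneg : ∀ X : ℝ, 0 < X → Ω₀ X < 0)
    (hlimsup : limsup (fun X : ℝ => ((|X * deriv Ω₀ X / Ω₀ X| : ℝ) : EReal)) (𝓝[≠] (0 : ℝ)) < ⊤)
    (hnorm : ∀ τ : ℝ, 0 ≤ τ → hilbertTransform (Ω τ) 0 = 2)
    (hnorm2 : ∀ τ : ℝ, 0 ≤ τ → iteratedDeriv 2 (hilbertTransform (Ω τ)) 0 = 4) :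
    (∀ τ : ℝ, 0 ≤ τ → cl τ = 1 / 2 ∧ cω τ = -1) ∧
    (∀ X : ℝ, X ≠ 1 → X ≠ -1 →
      Tendsto (fun τ => Ω τ X) atTop (𝓝 0) ∧
      Tendsto (fun τ => hilbertTransform (Ω τ) X) atTop (𝓝 (singularProfileHilbert X)) ∧
      singularProfileHilbert X = 2 / (1 - X ^ 2)) ∧
    (∀ φ : ℝ → ℝ, ContDiff ℝ ∞ φ → HasCompactSupport φ →
      Tendsto (fun τ => ∫ X : ℝ, Ω τ X * φ X) atTop (𝓝 (singularProfile φ))) := by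
  subst hinit
  have h : NormalizedSolution cl cω Ω :=
    ⟨hsol, hodd, hneg, tendsto_div_sq_of_odd hsmooth hodd hdeg, hnorm, hnorm2⟩
  refine ⟨fun τ hτ => ⟨h.cl_eq hτ, hsol.cω_eq h.zero_zero hnorm hτ⟩, fun X h1 h2 => ?_,
    fun φ hφ hs => h.tendsto_integral_mul hφ.continuous hs⟩
  obtain ⟨h3, h4⟩ := h.tendsto_pointwise h1 h2
  have h5 := singularProfileHilbert_eq h1 h2
  exact ⟨h3, by rwa [h5], h5⟩
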